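/- Let $A\in\mathbb Q^{m\times p}$, $G\in\mathbb Q^{m\times q}$, $b\in\mathbb Q^m$, $c\in\mathbb Q^p$, $h\in\mathbb Q^q$, let $P=\{(x,y)\in\mathbb R^{p+q}: Ax+Gy\le b\}$ and let $P_I=\operatorname{conv}\{(x,y)\in P: x\in\mathbb Z^p\}$. For $C\subseteq\mathbb R^{p+q}$ write $\operatorname{proj}_X(C)=\{x\in\mathbb R^p:\exists y\in\mathbb R^q,\ (x,y)\in C\}$. Let $k\ge 2$. A $k$-disjunction consists of $d^1,\dots,d^k\in\mathbb Z^p$ and $\delta^1,\dots,\delta^k\in\mathbb Z$ such that every $x\in\mathbb Z^p$ satisfies $d^ix\le\delta^i$ for at least one $i$; it contains a point $x\in\mathbb R^p$ if $d^ix\le\delta^i$ for at least one $i$. For a convex set $C\subseteq\mathbb R^{p+q}$, an inequality $\alpha x+\beta y\le\gamma$ with $\alpha\in\mathbb Q^p$, $\beta\in\mathbb Q^q$, $\gamma\in\mathbb R$ is a $k$-disjunctive cut for $C$ if it is valid for $C_I=\operatorname{conv}\{(x,y)\in C:x\in\mathbb Z^p\}$, is not valid for $C$, and there is a $k$-disjunction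 that contains $x$ for no $(x,y)\in C$ with $\alpha x+\beta y>\gamma$. The $k$-disjunctive closure of $C$ is the set of all points of $C$ that satisfy every $k$-disjunctive cut for $C$. Put $P_k^{(0)}=P$ and let $P_k^{(n+1)}$ be the $k$-disjunctive closure of $P_k^{(n)}$. **Theorem.** Suppose that $cx+hy$ is bounded above on $P$ and that $\gamma^*=\max\{cx+hy:(x,y)\in P_I\}$ exists (so $P_I\neq\emptyset$), and let $M=P_I\cap\{(x,y):cx+hy=\gamma^*\}$. Suppose that for every face $f$ of $M$ ($M$ itself included) with $\operatorname{relint}(\operatorname{proj}_X(f))\cap\mathbb Z^p=\emptyset$ there is a $k$-disjunction that contains no point of $\operatorname{relint}(\operatorname{proj}_X(f))$. Then there is an $n\in\mathbb N$ with $$\max\{cx+hy:(x,y)\in P_k^{(n)}\}=\gamma^*.$$ -/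

import Mathlib

namespace KDisjunctive

/-- The space `ℝ^(p+q)`; a point is a pair `(x, y)` with `x ∈ ℝ^p` the part subject to
integrality and `y ∈ ℝ^q` the continuous part. -/
abbrev MixedSpace (p q : ℕ) : Type := (Fin p → ℝ) × (Fin q → ℝ)

/-- The value `α x + β y` of the linear form with rational coefficient rows `α`, `β`. -/
def linForm {p q : ℕ} (α : Fin p → ℚ) (β : Fin q → ℚ) (z : MixedSpace p q) : ℝ :=
  (∑ j, (α j : ℝ) * z.1 j) + ∑ j, (β j : ℝ) * z.2 j

/-- The rational polyhedron `{(x, y) : A x + G y ≤ b}`. -/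
def polyhedron {m p q : ℕ} (A : Matrix (Fin m) (Fin p) ℚ) (G : Matrix (Fin m) (Fin q) ℚ)
    (b : Fin m → ℚ) : Set (MixedSpace p q) :=
  {z | ∀ i, linForm (A i) (G i) z ≤ (b i : ℝ)}

/-- The integer points `ℤ^p ⊆ ℝ^p`. -/
def integerPoints (p : ℕ) : Set (Fin p → ℝ) :=
  Set.range fun (u : Fin p → ℤ) (j : Fin p) => (u j : ℝ)

/-- The mixed integer hull `C_I = conv {(x, y) ∈ C : x ∈ ℤ^p}`. -/
def mixedIntegerHull {p q : ℕ} (C : Set (MixedSpace p q)) : Set (MixedSpace p q) :=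
  convexHull ℝ {z | z ∈ C ∧ z.1 ∈ integerPoints p}

/-- The projection on the space of the integer variables. -/
def projX {p q : ℕ} (C : Set (MixedSpace p q)) : Set (Fin p → ℝ) :=
  {x | ∃ y, (x, y) ∈ C}

/-- The union of the half-spaces `d^i x ≤ δ^i` in `ℝ^p`. -/
def disjunctionSet {p k : ℕ} (d : Fin k → Fin p → ℤ) (δ : Fin k → ℤ) : Set (Fin p → ℝ) :=
  {x | ∃ i, ∑ j, (d i j : ℝ) * x j ≤ (δ i : ℝ)}

/-- The inequalities `d^1 x ≤ δ^1, …, d^k x ≤ δ^k` form a `k`-disjunction: every integer point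
satisfies at least one of them. -/
def IsKDisjunction {p k : ℕ} (d : Fin k → Fin p → ℤ) (δ : Fin k → ℤ) : Prop :=
  integerPoints p ⊆ disjunctionSet d δ

/-- `α x + β y ≤ γ` is a cutting plane for `C`: valid for `C_I` but not for `C`. -/
def IsCuttingPlane {p q : ℕ} (C : Set (MixedSpace p q)) (α : Fin p → ℚ) (β : Fin q → ℚ)
    (γ : ℝ) : Prop :=
  (∀ z ∈ mixedIntegerHull C, linForm α β z ≤ γ) ∧ ¬ ∀ z ∈ C, linForm α β z ≤ γ

/-- `α x + β y ≤ γ` is a `k`-disjunctive cut for `C`: a cutting plane for which some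
`k`-disjunction contains the `x`-part of no point of `C` that is cut off. -/
def IsKDisjunctiveCut {p q : ℕ} (k : ℕ) (C : Set (MixedSpace p q)) (α : Fin p → ℚ)
    (β : Fin q → ℚ) (γ : ℝ) : Prop :=
  IsCuttingPlane C α β γ ∧
    ∃ (d : Fin k → Fin p → ℤ) (δ : Fin k → ℤ), IsKDisjunction d δ ∧
      ∀ z ∈ C, γ < linForm α β z → ∀ i, (δ i : ℝ) < ∑ j, (d i j : ℝ) * z.1 j

/-- The `k`-disjunctive closure of `C`: the points of `C` that satisfy all `k`-disjunctive
cuts for `C`. -/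
def kDisjunctiveClosure {p q : ℕ} (k : ℕ) (C : Set (MixedSpace p q)) : Set (MixedSpace p q) :=
  {z | z ∈ C ∧ ∀ (α : Fin p → ℚ) (β : Fin q → ℚ) (γ : ℝ),
    IsKDisjunctiveCut k C α β γ → linForm α β z ≤ γ}

/-- The `n`-th `k`-disjunctive closure of `C`, obtained by taking the `k`-disjunctive closure
`n` times (so the `0`-th one is `C` itself). -/
def iteratedClosure {p q : ℕ} (k : ℕ) (C : Set (MixedSpace p q)) : ℕ → Set (MixedSpace p q)
  | 0 => C
  | n + 1 => kDisjunctiveClosure k (iteratedClosure k C n)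

/-- The set `M = P_I ∩ {(x, y) : c x + h y = γ}`. -/
def solutionSet {p q : ℕ} (P : Set (MixedSpace p q)) (c : Fin p → ℚ) (h : Fin q → ℚ)
    (γ : ℝ) : Set (MixedSpace p q) :=
  mixedIntegerHull P ∩ {z | linForm c h z = γ}

end KDisjunctive

namespace KDisjunctive

/-! Call an inequality derivable if it is valid for some iterated closure. It suffices to derive `cx
+ hy ≤ γ*`, since every iterated closure contains `P_I`. No polyhedrality of the closures is used:
every step is a statement about finitely many derivable inequalities.

By Meyer's theorem (`mixedIntegerHull_generators`), `P_I` has finitely many rational generators. An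
inequality `e` valid for `P_I` with nonempty tight face inside `M` is derived by induction on the
number of tight generators (`derivable_of_tightFace_subset`). If the projected tight face has no
integer point in its relative interior, the hypothesis gives a `k`-disjunction missing that
interior, so `d^i x ≥ δ^i` on the face, strictly in the interior. Adding a small multiple of `-d^i x
≤ -δ^i` to `e` keeps it valid and shrinks the tight face, so the perturbed inequalities are
derivable. A point satisfying all of them but violating `e` has `d^i x > δ^i` for all `i`, so `e` is
itself a `k`-disjunctive cut, unless it is already valid. If the relative interior contains an
integer point `u`, linear programming duality over the fibre of `u` yields a split that serves the
same purpose (`derivable_of_integer_mem_intrinsicInterior`).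

Both cases rest on `derivable_of_forall_integer_lt`: splits suffice when all mixed integer points
satisfy the inequality strictly. If derivation failed, compactness and an extreme point argument
(`exists_evaluation_of_not_derivable`) would give a point of `P` violating or attaining the bound
and lying on no relevant open split; translating it along rays of constant objective
(`exists_integer_translate`) makes it mixed integer, a contradiction. -/

theorem linForm_add {p q : ℕ} (α : Fin p → ℚ) (β : Fin q → ℚ) (z w : MixedSpace p q) :
    linForm α β (z + w) = linForm α β z + linForm α β w := by
  simp only [linForm, Prod.fst_add, Prod.snd_add, Pi.add_apply, mul_add, Finset.sum_add_distrib]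
  ring

theorem linForm_smul {p q : ℕ} (α : Fin p → ℚ) (β : Fin q → ℚ) (r : ℝ) (z : MixedSpace p q) :
    linForm α β (r • z) = r * linForm α β z := by
  simp only [linForm, Prod.smul_fst, Prod.smul_snd, Pi.smul_apply, smul_eq_mul, mul_add,
    Finset.mul_sum]
  congr 1 <;> exact Finset.sum_congr rfl fun j _ => by ring

/-- `linForm α β` as a linear map. -/
def linFormₗ {p q : ℕ} (α : Fin p → ℚ) (β : Fin q → ℚ) : MixedSpace p q →ₗ[ℝ] ℝ where
  toFun := linForm α β
  map_add' := linForm_add α β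
  map_smul' r z := linForm_smul α β r z

@[simp] theorem linFormₗ_apply {p q : ℕ} (α : Fin p → ℚ) (β : Fin q → ℚ) (z : MixedSpace p q) :
    linFormₗ α β z = linForm α β z := rfl

theorem convex_linForm_le {p q : ℕ} (α : Fin p → ℚ) (β : Fin q → ℚ) (γ : ℝ) :
    Convex ℝ {z : MixedSpace p q | linForm α β z ≤ γ} :=
  convex_halfSpace_le (linFormₗ α β).isLinear γ

theorem convex_polyhedron {m p q : ℕ} (A : Matrix (Fin m) (Fin p) ℚ)
    (G : Matrix (Fin m) (Fin q) ℚ) (b : Fin m → ℚ) : Convex ℝ (polyhedron A G b) := by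
  have : polyhedron A G b = ⋂ i, {z | linForm (A i) (G i) z ≤ (b i : ℝ)} := by
    ext z; simp [polyhedron]
  rw [this]
  exact convex_iInter fun i => convex_linForm_le _ _ _

/-! ### Iterated closures and derivable inequalities. -/

section Closure

variable {p q k : ℕ} {C : Set (MixedSpace p q)}

theorem kDisjunctiveClosure_subset (k : ℕ) (C : Set (MixedSpace p q)) :
    kDisjunctiveClosure k C ⊆ C := fun _ hz => hz.1

theorem iteratedClosure_antitone (k : ℕ) (C : Set (MixedSpace p q)) :
    Antitone (iteratedClosure k C) :=
  antitone_nat_of_succ_le fun _ => kDisjunctiveClosure_subset _ _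

theorem iteratedClosure_subset (k : ℕ) (C : Set (MixedSpace p q)) (n : ℕ) :
    iteratedClosure k C n ⊆ C :=
  iteratedClosure_antitone k C (Nat.zero_le n)

theorem convex_iteratedClosure (k : ℕ) (hC : Convex ℝ C) (n : ℕ) :
    Convex ℝ (iteratedClosure k C n) := by
  induction n with
  | zero => exact hC
  | succ n ih =>
    intro z hz w hw a b ha hb hab
    exact ⟨ih hz.1 hw.1 ha hb hab, fun α β γ hcut =>
      convex_linForm_le α β γ (hz.2 α β γ hcut) (hw.2 α β γ hcut) ha hb hab⟩

theorem mem_iteratedClosure (k : ℕ) {z : MixedSpace p q} (hz : z ∈ C)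
    (hint : z.1 ∈ integerPoints p) (n : ℕ) : z ∈ iteratedClosure k C n := by
  induction n with
  | zero => exact hz
  | succ n ih => exact ⟨ih, fun α β γ hcut => hcut.1.1 z (subset_convexHull ℝ _ ⟨ih, hint⟩)⟩

theorem mixedIntegerHull_subset_iteratedClosure (k : ℕ) (hC : Convex ℝ C) (n : ℕ) :
    mixedIntegerHull C ⊆ iteratedClosure k C n :=
  convexHull_min (fun _ hz => mem_iteratedClosure k hz.1 hz.2 n) (convex_iteratedClosure k hC n)

/-- An inequality is derivable from `C` if it is valid for some iterated closure of `C`. -/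
def Derivable (k : ℕ) (C : Set (MixedSpace p q)) (α : Fin p → ℚ) (β : Fin q → ℚ) (γ : ℝ) : Prop :=
  ∃ n, ∀ z ∈ iteratedClosure k C n, linForm α β z ≤ γ

/-- An inequality valid for the mixed integer points all of whose violators in an iterated closure
avoid a `k`-disjunction is derivable. -/
theorem derivable_of_disjunction {α : Fin p → ℚ} {β : Fin q → ℚ} {γ : ℝ}
    (hval : ∀ z ∈ C, z.1 ∈ integerPoints p → linForm α β z ≤ γ) (n : ℕ)
    {d : Fin k → Fin p → ℤ} {δ : Fin k → ℤ} (hd : IsKDisjunction d δ)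
    (hcut : ∀ z ∈ iteratedClosure k C n, γ < linForm α β z →
      ∀ i, (δ i : ℝ) < ∑ j, (d i j : ℝ) * z.1 j) : Derivable k C α β γ := by
  refine ⟨n + 1, fun z hz => ?_⟩
  by_contra hlt
  refine hlt (hz.2 α β γ ⟨⟨fun w hw => ?_, fun hall => hlt (hall z hz.1)⟩, d, δ, hd, hcut⟩)
  refine convexHull_min ?_ (convex_linForm_le α β γ) hw
  exact fun w hw => hval w (iteratedClosure_subset k C n hw.1) hw.2

theorem sum_int_mul_mem {p : ℕ} (d : Fin p → ℤ) {x : Fin p → ℝ} (hx : x ∈ integerPoints p) :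
    ∃ n : ℤ, ∑ j, (d j : ℝ) * x j = n := by
  obtain ⟨u, rfl⟩ := hx
  exact ⟨∑ j, d j * u j, by push_cast; rfl⟩

theorem split_of_integer {p : ℕ} (d : Fin p → ℤ) (δ : ℤ) {x : Fin p → ℝ}
    (hx : x ∈ integerPoints p) :
    ∑ j, (d j : ℝ) * x j ≤ δ ∨ (δ + 1 : ℝ) ≤ ∑ j, (d j : ℝ) * x j := by
  obtain ⟨n, hn⟩ := sum_int_mul_mem d hx
  rw [hn]
  rcases le_or_gt n δ with h | h
  · left; exact_mod_cast h
  · right; exact_mod_cast h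

/-- The cut rule for split disjunctions. -/
theorem derivable_of_split (hk : 2 ≤ k) {α : Fin p → ℚ} {β : Fin q → ℚ} {γ : ℝ}
    (hval : ∀ z ∈ C, z.1 ∈ integerPoints p → linForm α β z ≤ γ) (n : ℕ)
    (d : Fin p → ℤ) (δ : ℤ)
    (hcut : ∀ z ∈ iteratedClosure k C n, γ < linForm α β z →
      (δ : ℝ) < ∑ j, (d j : ℝ) * z.1 j ∧ ∑ j, (d j : ℝ) * z.1 j < δ + 1) :
    Derivable k C α β γ := by
  -- The split has two terms; the second is repeated to fill the remaining `k - 1` places.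
  refine derivable_of_disjunction (k := k) hval n
    (d := fun i => if i.val = 0 then d else -d)
    (δ := fun i => if i.val = 0 then δ else -(δ + 1)) ?_ ?_
  · intro x hx
    rcases split_of_integer d δ hx with h | h
    · exact ⟨⟨0, by omega⟩, by simpa using h⟩
    · refine ⟨⟨1, by omega⟩, ?_⟩
      simp only [one_ne_zero, if_false, Pi.neg_apply, Int.cast_neg, neg_mul,
        Finset.sum_neg_distrib, Int.cast_add, Int.cast_one]
      linarith
  · intro z hz hlt i
    obtain ⟨h1, h2⟩ := hcut z hz hlt
    by_cases hi : i.val = 0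
    · simpa [hi] using h1
    · simp only [hi, if_false, Pi.neg_apply, Int.cast_neg, neg_mul, Finset.sum_neg_distrib,
        Int.cast_add, Int.cast_one]
      linarith

end Closure

/-! ### Generators of rational cones and the Farkas lemma. -/

/-- Double description of a rational polyhedral cone: finitely many rational generators, together
with the Farkas lemma for them. -/
theorem double_description {ι : Type} [Fintype ι] [DecidableEq ι] {m : ℕ} (a : Fin m → ι → ℚ) :
    ∃ (I : Type) (_ : Fintype I) (g : I → ι → ℚ),
      (∀ i k, ∑ j, a k j * g i j ≤ 0) ∧
      (∀ z : ι → ℝ, (∀ k, ∑ j, (a k j : ℝ) * z j ≤ 0) →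
        ∃ l : I → ℝ, (∀ i, 0 ≤ l i) ∧ ∀ j, z j = ∑ i, l i * (g i j : ℝ)) ∧
      (∀ w : ι → ℚ, (∀ i, ∑ j, w j * g i j ≤ 0) →
        ∃ u : Fin m → ℚ, (∀ k, 0 ≤ u k) ∧ ∀ j, w j = ∑ k, u k * a k j) := by
  induction m with
  | zero =>
    -- With no constraints the cone is the whole space, generated by the vectors `± e_i`.
    refine ⟨ι ⊕ ι, inferInstance, Sum.elim (fun i => Pi.single i 1) (fun i => -Pi.single i 1),
      fun _ k => k.elim0, fun z _ => ?_, fun w hw => ?_⟩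
    · refine ⟨Sum.elim (fun i => max (z i) 0) (fun i => max (-z i) 0), ?_, fun j => ?_⟩
      · rintro (i | i) <;> simp
      · have h1 : ∀ x : ℝ, x = max x 0 - max (-x) 0 := fun x => by
          rcases le_total x 0 with h | h
          · rw [max_eq_right h, max_eq_left (by linarith)]; ring
          · rw [max_eq_left h, max_eq_right (by linarith)]; ring
        simp only [Fintype.sum_sum_type, Sum.elim_inl, Sum.elim_inr, Pi.neg_apply, Pi.single_apply,
          Rat.cast_neg, apply_ite (Rat.cast (K := ℝ)), Rat.cast_one, Rat.cast_zero, mul_neg,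
          mul_ite, mul_one, mul_zero, Finset.sum_neg_distrib, Finset.sum_ite_eq, Finset.mem_univ,
          if_true]
        linarith [h1 (z j)]
    · refine ⟨Fin.elim0, fun k => k.elim0, fun j => ?_⟩
      have h1 := hw (Sum.inl j)
      have h2 := hw (Sum.inr j)
      simp [Pi.single_apply] at h1 h2
      simpa using le_antisymm h1 h2
  | succ m ih =>
    obtain ⟨I, _, g, hg, hM, hF⟩ := ih (fun k => a k.castSucc)
    set c : ι → ℚ := a (Fin.last m) with hc
    set v : I → ℚ := fun i => ∑ j, c j * g i j with hv
    -- Generators on the allowed side of the new constraint are kept. Each pair on strictly opposite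
    -- sides is combined so that the result lies on the hyperplane; unused indices carry the zero
    -- vector.
    set g' : I ⊕ (I × I) → ι → ℚ := Sum.elim (fun i => if v i ≤ 0 then g i else 0)
      (fun ij => if 0 < v ij.1 ∧ v ij.2 < 0 then v ij.1 • g ij.2 - v ij.2 • g ij.1 else 0) with hg'
    refine ⟨I ⊕ (I × I), inferInstance, g', ?_, fun z hz => ?_, fun w hw => ?_⟩
    · have key : ∀ (e : ι → ℚ) (r s : ℚ) (i i' : I),
          ∑ j, e j * (r • g i' - s • g i) j
            = r * ∑ j, e j * g i' j - s * ∑ j, e j * g i j := by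
        intro e r s i i'
        rw [Finset.mul_sum, Finset.mul_sum, ← Finset.sum_sub_distrib]
        exact Finset.sum_congr rfl fun j _ => by simp; ring
      rintro (i | ⟨i, i'⟩) k
      · by_cases hi : v i ≤ 0
        · simp only [hg', Sum.elim_inl, hi, if_true]
          refine Fin.lastCases ?_ (fun k => ?_) k
          · exact hi
          · exact hg i k
        · simp [hg', hi]
      · by_cases hi : 0 < v i ∧ v i' < 0
        · simp only [hg', Sum.elim_inr, hi, and_self, if_true]
          rw [key]
          refine Fin.lastCases ?_ (fun k => ?_) k
          · change v i * v i' - v i' * v i ≤ 0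
            linarith [mul_comm (v i) (v i')]
          · nlinarith [mul_nonneg hi.1.le (neg_nonneg.2 (hg i' k)),
              mul_nonneg (neg_nonneg.2 hi.2.le) (neg_nonneg.2 (hg i k))]
        · simp [hg', hi]
    · obtain ⟨l, hl, hzl⟩ := hM z fun k => hz k.castSucc
      -- `P` and `N` are the positive and negative parts of `c z`; the new constraint says `P ≤ N`,
      -- so the positive part can be absorbed entirely by pairs.
      set P : ℝ := ∑ i, if 0 < v i then l i * (v i : ℝ) else 0 with hP
      set N : ℝ := ∑ i, if v i < 0 then l i * (-(v i : ℝ)) else 0 with hN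
      have hPi : ∀ i, 0 ≤ if 0 < v i then l i * (v i : ℝ) else 0 := fun i => by
        split_ifs with h
        · exact mul_nonneg (hl i) (by exact_mod_cast h.le)
        · exact le_rfl
      have hNi : ∀ i, 0 ≤ if v i < 0 then l i * (-(v i : ℝ)) else 0 := fun i => by
        split_ifs with h
        · exact mul_nonneg (hl i) (by have : (v i : ℝ) < 0 := by exact_mod_cast h
                                      linarith)
        · exact le_rfl
      have hP0 : 0 ≤ P := Finset.sum_nonneg fun i _ => hPi i
      have hN0 : 0 ≤ N := Finset.sum_nonneg fun i _ => hNi i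
      have hPN : P ≤ N := by
        have h1 := hz (Fin.last m)
        have h2 : ∑ j, (c j : ℝ) * z j = P - N := by
          rw [hP, hN, ← Finset.sum_sub_distrib]
          calc ∑ j, (c j : ℝ) * z j = ∑ j, ∑ i, (c j : ℝ) * (l i * (g i j : ℝ)) := by
                simp_rw [hzl, Finset.mul_sum]
            _ = ∑ i, l i * (v i : ℝ) := by
                rw [Finset.sum_comm]
                refine Finset.sum_congr rfl fun i _ => ?_
                simp only [hv]
                push_cast
                rw [Finset.mul_sum]
                exact Finset.sum_congr rfl fun j _ => by ring
            _ = _ := by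
                refine Finset.sum_congr rfl fun i _ => ?_
                rcases lt_trichotomy (v i) 0 with h | h | h
                · simp [h, not_lt.2 h.le]
                · simp [h]
                · simp [h, not_lt.2 h.le]
        rw [← hc, h2] at h1
        linarith
      have hPz : N = 0 → ∀ i, 0 < v i → l i = 0 := by
        intro hN' i hi
        have hP' : P = 0 := le_antisymm (hN' ▸ hPN) hP0
        have := (Finset.sum_eq_zero_iff_of_nonneg fun i _ => hPi i).1 hP' i (Finset.mem_univ i)
        simp only [hi, if_true] at this
        rcases mul_eq_zero.1 this with h | h
        · exact h
        · exact absurd (by exact_mod_cast h : v i = 0) hi.ne'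
      -- The pair weights `l i * l i' / N` use up every positive generator and the fraction `P / N`
      -- of every negative one. If `N = 0`, division gives `0`, and `hPz` shows that the positive
      -- generators had weight `0`.
      refine ⟨Sum.elim (fun i => if v i < 0 then l i * (1 - P / N) else l i)
        (fun ij => l ij.1 * l ij.2 / N), ?_, fun j => ?_⟩
      · rintro (i | ⟨i, i'⟩)
        · simp only [Sum.elim_inl]
          split_ifs
          · exact mul_nonneg (hl i) (sub_nonneg.2 (div_le_one_of_le₀ hPN hN0))
          · exact hl i
        · exact div_nonneg (mul_nonneg (hl i) (hl i')) hN0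
      · rw [Fintype.sum_sum_type, Fintype.sum_prod_type]
        have e1 : ∀ i i', l i * l i' / N * (g' (Sum.inr (i, i')) j : ℝ)
            = (if 0 < v i then l i * (v i : ℝ) else 0) *
                (if v i' < 0 then l i' * (g i' j : ℝ) else 0) / N
              + (if v i' < 0 then l i' * (-(v i' : ℝ)) else 0) *
                (if 0 < v i then l i * (g i j : ℝ) else 0) / N := by
          intro i i'
          by_cases h1 : 0 < v i <;> by_cases h2 : v i' < 0 <;> simp [hg', h1, h2]
          ring
        simp only [Sum.elim_inr, Sum.elim_inl, e1, Finset.sum_add_distrib]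
        have e2 : ∀ (x y : I → ℝ), ∑ i, ∑ i', x i * y i' / N = (∑ i, x i) * (∑ i, y i) / N := by
          intro x y
          rw [Finset.sum_mul_sum, Finset.sum_div]
          exact Finset.sum_congr rfl fun i _ => (Finset.sum_div _ _ _).symm
        rw [e2, Finset.sum_comm (f := fun i i' => (if v i' < 0 then l i' * (-(v i' : ℝ)) else 0) *
                (if 0 < v i then l i * (g i j : ℝ) else 0) / N), e2, ← hP, ← hN]
        have e3 : N * (∑ i, if 0 < v i then l i * (g i j : ℝ) else 0) / N
            = ∑ i, if 0 < v i then l i * (g i j : ℝ) else 0 := by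
          by_cases hN' : N = 0
          · rw [Finset.sum_eq_zero]
            · simp
            · intro i _
              split_ifs with h
              · rw [hPz hN' i h, zero_mul]
              · rfl
          · field_simp
        rw [e3, mul_div_right_comm, Finset.mul_sum, ← Finset.sum_add_distrib,
          ← Finset.sum_add_distrib, hzl]
        refine Finset.sum_congr rfl fun i _ => ?_
        rcases lt_trichotomy (v i) 0 with h | h | h
        · simp [hg', h, h.le, not_lt.2 h.le]; ring
        · simp [hg', h]
        · simp [hg', h, not_lt.2 h.le, not_le.2 h]
    · set W : I → ℚ := fun i => ∑ j, w j * g i j with hW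
      have hw1 : ∀ i, v i ≤ 0 → W i ≤ 0 := fun i hi => by
        have := hw (Sum.inl i)
        simpa only [hg', Sum.elim_inl, hi, if_true] using this
      have hw2 : ∀ i i', 0 < v i → v i' < 0 → v i * W i' - v i' * W i ≤ 0 := fun i i' hi hi' => by
        have := hw (Sum.inr (i, i'))
        simp only [hg', Sum.elim_inr, hi, hi', and_self, if_true] at this
        convert this using 1
        simp only [hW]
        rw [Finset.mul_sum, Finset.mul_sum, ← Finset.sum_sub_distrib]
        exact Finset.sum_congr rfl fun j _ => by simp; ring
      -- `μ` is the multiplier of the new constraint. Positive generators bound it below by `W i / v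
      -- i`, negative ones above; the inequalities at the pairs make the bounds compatible.
      obtain ⟨μ, hμ0, hμ⟩ : ∃ μ : ℚ, 0 ≤ μ ∧ ∀ i, W i - μ * v i ≤ 0 := by
        set S : Finset ℚ := insert 0 ((Finset.univ.filter fun i => 0 < v i).image
          fun i => W i / v i) with hS
        have hSne : S.Nonempty := ⟨0, by simp [hS]⟩
        refine ⟨S.max' hSne, S.le_max' 0 (by simp [hS]), fun i => ?_⟩
        rcases lt_trichotomy (v i) 0 with h | h | h
        · have hle : S.max' hSne ≤ W i / v i := by
            refine Finset.max'_le _ _ _ fun y hy => ?_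
            rw [hS, Finset.mem_insert, Finset.mem_image] at hy
            rcases hy with rfl | ⟨i', hi', rfl⟩
            · exact div_nonneg_of_nonpos (hw1 i h.le) h.le
            · have hi'' : 0 < v i' := by simpa using hi'
              have := hw2 i' i hi'' h
              rw [le_div_iff_of_neg h, div_mul_eq_mul_div, le_div_iff₀ hi'']
              linarith
          have := (le_div_iff_of_neg h).1 hle
          linarith
        · simpa [h] using hw1 i h.le
        · have hle : W i / v i ≤ S.max' hSne := by
            refine S.le_max' _ ?_
            rw [hS, Finset.mem_insert, Finset.mem_image]
            exact Or.inr ⟨i, by simpa using h, rfl⟩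
          have := (div_le_iff₀ h).1 hle
          linarith
      obtain ⟨u, hu, huw⟩ := hF (w - μ • c) fun i => by
        convert hμ i using 1
        simp only [hW, hv]
        rw [Finset.mul_sum, ← Finset.sum_sub_distrib]
        exact Finset.sum_congr rfl fun j _ => by simp; ring
      refine ⟨Fin.snoc u μ, fun k => ?_, fun j => ?_⟩
      · refine Fin.lastCases ?_ (fun k => ?_) k
        · simpa using hμ0
        · simpa using hu k
      · have := huw j
        simp only [Pi.sub_apply, Pi.smul_apply, smul_eq_mul] at this
        rw [Fin.sum_univ_castSucc]
        simp only [Fin.snoc_castSucc, Fin.snoc_last, ← hc]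
        linarith

theorem exists_nat_mul_eq_int {ι : Type} [Fintype ι] (g : ι → ℚ) :
    ∃ N : ℕ, 0 < N ∧ ∀ j, ∃ n : ℤ, (N : ℚ) * g j = n := by
  classical
  refine ⟨∏ j, (g j).den, Finset.prod_pos fun j _ => (g j).den_pos, fun j => ?_⟩
  refine ⟨(∏ i ∈ Finset.univ.erase j, (g i).den : ℕ) * (g j).num, ?_⟩
  rw [← Finset.prod_erase_mul _ _ (Finset.mem_univ j)]
  push_cast
  rw [mul_assoc, Rat.den_mul_eq_num]

/-- In the double description the generators can be taken integral. -/
theorem double_description_int {ι : Type} [Fintype ι] [DecidableEq ι] {m : ℕ}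
    (a : Fin m → ι → ℚ) :
    ∃ (I : Type) (_ : Fintype I) (g : I → ι → ℚ),
      (∀ i j, ∃ n : ℤ, g i j = n) ∧
      (∀ i k, ∑ j, a k j * g i j ≤ 0) ∧
      (∀ z : ι → ℝ, (∀ k, ∑ j, (a k j : ℝ) * z j ≤ 0) →
        ∃ l : I → ℝ, (∀ i, 0 ≤ l i) ∧ ∀ j, z j = ∑ i, l i * (g i j : ℝ)) ∧
      (∀ w : ι → ℚ, (∀ i, ∑ j, w j * g i j ≤ 0) →
        ∃ u : Fin m → ℚ, (∀ k, 0 ≤ u k) ∧ ∀ j, w j = ∑ k, u k * a k j) := by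
  obtain ⟨I, hI, g, h1, h2, h3⟩ := double_description a
  choose N hN0 hN using fun i => exists_nat_mul_eq_int (g i)
  have key : ∀ (w : ι → ℚ) i, ∑ j, w j * (N i * g i j) = N i * ∑ j, w j * g i j := by
    intro w i
    rw [Finset.mul_sum]
    exact Finset.sum_congr rfl fun j _ => by ring
  have hNQ : ∀ i, (0 : ℚ) < N i := fun i => by exact_mod_cast hN0 i
  have hNR : ∀ i, (0 : ℝ) < N i := fun i => by exact_mod_cast hN0 i
  refine ⟨I, hI, fun i j => N i * g i j, hN, fun i k => ?_, fun z hz => ?_, fun w hw => ?_⟩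
  · rw [key]
    exact mul_nonpos_of_nonneg_of_nonpos (hNQ i).le (h1 i k)
  · obtain ⟨l, hl, hlz⟩ := h2 z hz
    refine ⟨fun i => l i / N i, fun i => div_nonneg (hl i) (hNR i).le, fun j => ?_⟩
    rw [hlz]
    refine Finset.sum_congr rfl fun i _ => ?_
    have := (hNR i).ne'
    push_cast
    field_simp
  · refine h3 w fun i => ?_
    have := hw i
    rw [key] at this
    exact nonpos_of_mul_nonpos_right this (hNQ i)

/-! ### Homogeneous generators of rational polyhedra. -/

/-- The real point with the given rational coordinates. -/
def castPt {p q : ℕ} (g : (Fin p → ℚ) × (Fin q → ℚ)) : MixedSpace p q :=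
  (fun j => (g.1 j : ℝ), fun j => (g.2 j : ℝ))

/-- The linear form with rational coefficients on rational points. -/
def linFormQ {p q : ℕ} (α : Fin p → ℚ) (β : Fin q → ℚ) (g : (Fin p → ℚ) × (Fin q → ℚ)) : ℚ :=
  (∑ j, α j * g.1 j) + ∑ j, β j * g.2 j

theorem linForm_castPt {p q : ℕ} (α : Fin p → ℚ) (β : Fin q → ℚ)
    (g : (Fin p → ℚ) × (Fin q → ℚ)) : linForm α β (castPt g) = (linFormQ α β g : ℝ) := by
  simp [linForm, linFormQ, castPt]

/-- The set generated by the homogeneous rational generators `(g i, t i)`. -/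
def genSet {p q : ℕ} {I : Type} [Fintype I] (g : I → (Fin p → ℚ) × (Fin q → ℚ)) (t : I → ℚ) :
    Set (MixedSpace p q) :=
  {z | ∃ l : I → ℝ, (∀ i, 0 ≤ l i) ∧ ∑ i, l i * (t i : ℝ) = 1 ∧ ∑ i, l i • castPt (g i) = z}

section GenSet

variable {p q : ℕ} {I : Type} [Fintype I] {g : I → (Fin p → ℚ) × (Fin q → ℚ)} {t : I → ℚ}

theorem convex_genSet : Convex ℝ (genSet g t) := by
  rintro _ ⟨l, hl, hl1, rfl⟩ _ ⟨l', hl', hl1', rfl⟩ a b ha hb hab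
  refine ⟨fun i => a * l i + b * l' i, fun i =>
    add_nonneg (mul_nonneg ha (hl i)) (mul_nonneg hb (hl' i)), ?_, ?_⟩
  · simp only [add_mul, mul_assoc, Finset.sum_add_distrib, ← Finset.mul_sum, hl1, hl1', mul_one,
      hab]
  · simp only [add_smul, mul_smul, Finset.sum_add_distrib, ← Finset.smul_sum]

theorem genSet_le (L : MixedSpace p q →ₗ[ℝ] ℝ) {γ : ℝ} (h : ∀ i, L (castPt (g i)) ≤ γ * t i)
    {z : MixedSpace p q} (hz : z ∈ genSet g t) : L z ≤ γ := by
  obtain ⟨l, hl, hl1, rfl⟩ := hz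
  rw [map_sum]
  calc ∑ i, L (l i • castPt (g i)) ≤ ∑ i, γ * (l i * t i) := by
        refine Finset.sum_le_sum fun i _ => ?_
        rw [map_smul, smul_eq_mul]
        calc _ ≤ l i * (γ * t i) := mul_le_mul_of_nonneg_left (h i) (hl i)
          _ = _ := by ring
    _ = γ := by rw [← Finset.mul_sum, hl1, mul_one]

theorem add_smul_mem_genSet {z : MixedSpace p q} (hz : z ∈ genSet g t) {i : I} (hi : t i = 0)
    {r : ℝ} (hr : 0 ≤ r) : z + r • castPt (g i) ∈ genSet g t := by
  classical
  obtain ⟨l, hl, hl1, rfl⟩ := hz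
  refine ⟨fun j => l j + if j = i then r else 0, fun j => ?_, ?_, ?_⟩
  · dsimp only
    split_ifs
    · exact add_nonneg (hl j) hr
    · simpa using hl j
  · simp [add_mul, Finset.sum_add_distrib, hl1, hi]
  · simp [add_smul, Finset.sum_add_distrib]

theorem inv_smul_mem_genSet {i : I} (hi : 0 < t i) :
    (t i : ℝ)⁻¹ • castPt (g i) ∈ genSet g t := by
  classical
  have hi' : (0 : ℝ) < t i := by exact_mod_cast hi
  refine ⟨fun j => if j = i then (t i : ℝ)⁻¹ else 0, fun j => ?_, ?_, ?_⟩
  · dsimp only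
    split_ifs
    · positivity
    · exact le_rfl
  · simp [hi'.ne']
  · simp

theorem nonpos_of_mul_nat_le {a b c : ℝ} (h : ∀ n : ℕ, a + n * b ≤ c) : b ≤ 0 := by
  by_contra hb
  push Not at hb
  obtain ⟨n, hn⟩ := exists_nat_gt ((c - a) / b)
  rw [div_lt_iff₀ hb] at hn
  linarith [h n]

/-- A generator with `t i > 0` scales to a point of the set; one with `t i = 0` can be added
arbitrarily often, so a bounded form is nonpositive on it. -/
theorem le_of_genSet_le (L : MixedSpace p q →ₗ[ℝ] ℝ) {γ : ℝ} (ht : ∀ i, 0 ≤ t i)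
    (hne : (genSet g t).Nonempty) (h : ∀ z ∈ genSet g t, L z ≤ γ) (i : I) :
    L (castPt (g i)) ≤ γ * t i := by
  rcases (ht i).eq_or_lt with hi | hi
  · obtain ⟨z, hz⟩ := hne
    rw [← hi, Rat.cast_zero, mul_zero]
    refine nonpos_of_mul_nat_le (a := L z) (c := γ) fun n => ?_
    have := h _ (add_smul_mem_genSet hz hi.symm (Nat.cast_nonneg n))
    simpa using this
  · have := h _ (inv_smul_mem_genSet hi)
    rw [map_smul, smul_eq_mul, inv_mul_eq_div, div_le_iff₀ (by exact_mod_cast hi)] at this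
    exact this

/-- The weights `l i * t i` turn the generators with `t i > 0` into a convex combination; the rays
are then added one at a time. -/
theorem genSet_subset {S : Set (MixedSpace p q)} (hS : Convex ℝ S) (ht : ∀ i, 0 ≤ t i)
    (hpos : ∀ i, 0 < t i → (t i : ℝ)⁻¹ • castPt (g i) ∈ S)
    (hray : ∀ i, t i = 0 → ∀ z ∈ S, ∀ r : ℝ, 0 ≤ r → z + r • castPt (g i) ∈ S) :
    genSet g t ⊆ S := by
  classical
  rintro _ ⟨l, hl, hl1, rfl⟩
  rw [← Finset.sum_filter_add_sum_filter_not Finset.univ (fun i => 0 < t i)]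
  have hbase : ∑ i with 0 < t i, l i • castPt (g i) ∈ S := by
    have : ∑ i with 0 < t i, l i • castPt (g i)
        = ∑ i with 0 < t i, (l i * t i) • ((t i : ℝ)⁻¹ • castPt (g i)) := by
      refine Finset.sum_congr rfl fun i hi => ?_
      have : (t i : ℝ) ≠ 0 := by
        have : 0 < t i := by simpa using hi
        exact_mod_cast this.ne'
      rw [smul_smul, mul_assoc, mul_inv_cancel₀ this, mul_one]
    rw [this]
    refine hS.sum_mem (fun i _ => mul_nonneg (hl i) (by exact_mod_cast ht i)) ?_ fun i hi =>
      hpos i (by simpa using hi)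
    rw [← hl1, Finset.sum_filter]
    refine Finset.sum_congr rfl fun i _ => ?_
    split_ifs with h
    · rfl
    · have : t i = 0 := le_antisymm (not_lt.1 h) (ht i)
      simp [this]
  have hind : ∀ s : Finset I, (∀ i ∈ s, t i = 0) → ∀ z ∈ S,
      z + ∑ i ∈ s, l i • castPt (g i) ∈ S := by
    intro s
    induction s using Finset.induction_on with
    | empty => intro _ z hz; simpa using hz
    | insert i s hi ih =>
      intro hs z hz
      rw [Finset.sum_insert hi, ← add_assoc]
      exact ih (fun j hj => hs j (Finset.mem_insert_of_mem hj)) _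
        (hray i (hs i (Finset.mem_insert_self i s)) z hz _ (hl i))
  refine hind _ (fun i hi => ?_) _ hbase
  exact le_antisymm (not_lt.1 (by simpa using hi)) (ht i)

end GenSet

theorem linForm_le_of_genSet {p q : ℕ} {I : Type} [Fintype I]
    {g : I → (Fin p → ℚ) × (Fin q → ℚ)} {t : I → ℚ} {α : Fin p → ℚ} {β : Fin q → ℚ} {γ : ℚ}
    (h : ∀ i, linFormQ α β (g i) ≤ γ * t i) {z : MixedSpace p q} (hz : z ∈ genSet g t) :
    linForm α β z ≤ γ :=
  genSet_le (linFormₗ α β) (fun i => by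
    rw [linFormₗ_apply, linForm_castPt]; exact_mod_cast h i) hz

/-- A rational polyhedron is finitely generated, with integral generators in the integer
coordinates, and satisfies the Farkas lemma. -/
theorem polyhedron_generators {m p q : ℕ} (A : Matrix (Fin m) (Fin p) ℚ)
    (G : Matrix (Fin m) (Fin q) ℚ) (b : Fin m → ℚ) :
    ∃ (I : Type) (_ : Fintype I) (g : I → (Fin p → ℚ) × (Fin q → ℚ)) (t : I → ℚ),
      (∀ i, 0 ≤ t i) ∧ (∀ i j, ∃ n : ℤ, (g i).1 j = n) ∧
      (∀ i k, linFormQ (A k) (G k) (g i) ≤ b k * t i) ∧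
      polyhedron A G b = genSet g t ∧
      ∀ (α : Fin p → ℚ) (β : Fin q → ℚ) (θ : ℚ), (∀ i, linFormQ α β (g i) ≤ θ * t i) →
        ∃ u : Fin m → ℚ, (∀ k, 0 ≤ u k) ∧ (∀ j, α j = ∑ k, u k * A k j) ∧
          (∀ j, β j = ∑ k, u k * G k j) ∧ ∑ k, u k * b k ≤ θ := by
  -- Homogenisation: the extra coordinate `t` satisfies `-t ≤ 0` and `Ax + Gy - bt ≤ 0`, and the
  -- polyhedron is the slice `t = 1`.
  obtain ⟨I, hI, g, hint, h1, h2, h3⟩ := double_description_int (ι := Fin p ⊕ Fin q ⊕ Unit)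
    (m := m + 1) (Fin.cons (Sum.elim 0 (Sum.elim 0 (-1)))
      fun k => Sum.elim (A k) (Sum.elim (G k) fun _ => -b k))
  simp only [Fintype.sum_sum_type, Fin.forall_fin_succ, Fin.cons_zero, Fin.cons_succ,
    Sum.elim_inl, Sum.elim_inr, Finset.univ_unique, Finset.sum_singleton, Pi.zero_apply,
    zero_mul, Finset.sum_const_zero, zero_add, Pi.neg_apply, Pi.one_apply, neg_mul, one_mul,
    Rat.cast_neg, Rat.cast_one, Rat.cast_zero] at h1 h2
  have hge : ∀ i k, linFormQ (A k) (G k)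
      (fun j => g i (Sum.inl j), fun j => g i (Sum.inr (Sum.inl j)))
        ≤ b k * g i (Sum.inr (Sum.inr ())) := by
    intro i k
    have := (h1 i).2 k
    simp only [linFormQ]
    change _ + (_ + -(b k * g i (Sum.inr (Sum.inr ())))) ≤ 0 at this
    linarith
  refine ⟨I, hI, fun i => (fun j => g i (Sum.inl j), fun j => g i (Sum.inr (Sum.inl j))),
    fun i => g i (Sum.inr (Sum.inr ())), fun i => ?_, fun i j => hint i _, hge, ?_, ?_⟩
  · exact neg_nonpos.1 (h1 i).1
  · ext z
    constructor
    · intro hz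
      obtain ⟨l, hl, hlz⟩ := h2 (Sum.elim z.1 (Sum.elim z.2 1)) ⟨by simp, fun k => by
        have := hz k
        simp only [linForm] at this
        simp only [Sum.elim_inl, Sum.elim_inr, Pi.one_apply, mul_one]
        linarith⟩
      refine ⟨l, hl, ?_, ?_⟩
      · simpa using (hlz (Sum.inr (Sum.inr ()))).symm
      · refine Prod.ext ?_ ?_
        · funext j
          simpa [castPt, Prod.fst_sum, Finset.sum_apply] using (hlz (Sum.inl j)).symm
        · funext j
          simpa [castPt, Prod.snd_sum, Finset.sum_apply] using (hlz (Sum.inr (Sum.inl j))).symm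
    · intro hz k
      exact linForm_le_of_genSet (fun i => hge i k) hz
  · intro α β θ h
    obtain ⟨u, hu, huw⟩ := h3 (Sum.elim α (Sum.elim β fun _ => -θ)) fun i => by
      have := h i
      simp only [linFormQ] at this
      simp only [Fintype.sum_sum_type, Sum.elim_inl, Sum.elim_inr, Finset.univ_unique,
        Finset.sum_singleton]
      change _ + (_ + -θ * g i (Sum.inr (Sum.inr ()))) ≤ 0
      linarith
    refine ⟨fun k => u k.succ, fun k => hu _, fun j => ?_, fun j => ?_, ?_⟩
    · simpa [Fin.sum_univ_succ] using huw (Sum.inl j)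
    · simpa [Fin.sum_univ_succ] using huw (Sum.inr (Sum.inl j))
    · have := huw (Sum.inr (Sum.inr ()))
      simp [Fin.sum_univ_succ] at this
      linarith [hu 0]

/-! ### Integer points and Meyer's theorem. -/

theorem add_mem_integerPoints {p : ℕ} {x y : Fin p → ℝ} (hx : x ∈ integerPoints p)
    (hy : y ∈ integerPoints p) : x + y ∈ integerPoints p := by
  obtain ⟨u, rfl⟩ := hx
  obtain ⟨v, rfl⟩ := hy
  exact ⟨u + v, by funext j; simp⟩

theorem int_smul_mem_integerPoints {p : ℕ} {x : Fin p → ℝ} (hx : x ∈ integerPoints p) (n : ℤ) :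
    (n : ℝ) • x ∈ integerPoints p := by
  obtain ⟨u, rfl⟩ := hx
  exact ⟨n • u, by funext j; simp⟩

theorem sum_mem_integerPoints {p : ℕ} {I : Type} (s : Finset I) {x : I → Fin p → ℝ}
    (hx : ∀ i ∈ s, x i ∈ integerPoints p) : ∑ i ∈ s, x i ∈ integerPoints p := by
  classical
  induction s using Finset.induction_on with
  | empty => exact ⟨0, by funext j; simp⟩
  | insert i s hi ih =>
    rw [Finset.sum_insert hi]
    exact add_mem_integerPoints (hx i (Finset.mem_insert_self i s))
      (ih fun j hj => hx j (Finset.mem_insert_of_mem hj))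

theorem castPt_mem_integerPoints {p q : ℕ} {g : (Fin p → ℚ) × (Fin q → ℚ)}
    (hg : ∀ j, ∃ n : ℤ, g.1 j = n) : (castPt g).1 ∈ integerPoints p := by
  choose u hu using hg
  exact ⟨u, by funext j; simp [castPt, hu]⟩

/-- The mixed integer hull is closed under adding integral recession directions. -/
theorem add_smul_mem_mixedIntegerHull {p q : ℕ} {C : Set (MixedSpace p q)} {r : MixedSpace p q}
    (hr : r.1 ∈ integerPoints p) (hC : ∀ z ∈ C, ∀ n : ℕ, z + (n : ℝ) • r ∈ C)
    {z : MixedSpace p q} (hz : z ∈ mixedIntegerHull C) {ν : ℝ} (hν : 0 ≤ ν) :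
    z + ν • r ∈ mixedIntegerHull C := by
  have hconv : Convex ℝ {z | z + ν • r ∈ mixedIntegerHull C} := by
    intro x hx y hy a b ha hb hab
    have h := convex_convexHull ℝ {z | z ∈ C ∧ z.1 ∈ integerPoints p} hx hy ha hb hab
    have e : a • (x + ν • r) + b • (y + ν • r) = a • x + b • y + ν • r := by
      rw [smul_add, smul_add, add_add_add_comm, ← add_smul, hab, one_smul]
    rw [e] at h
    exact h
  refine convexHull_min ?_ hconv hz
  rintro w ⟨hw, hwi⟩
  -- For a mixed integer `w`, the point `w + ν r` lies between `w` and the mixed integer point `w +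
  -- N r`.
  obtain ⟨N, hN⟩ := exists_nat_gt ν
  have hN0 : (0 : ℝ) < N := hν.trans_lt hN
  have h1 : w ∈ mixedIntegerHull C := subset_convexHull ℝ _ ⟨hw, hwi⟩
  have h2 : w + (N : ℝ) • r ∈ mixedIntegerHull C :=
    subset_convexHull ℝ _ ⟨hC w hw N, add_mem_integerPoints hwi
      (by exact_mod_cast int_smul_mem_integerPoints hr N)⟩
  have h := convex_convexHull ℝ {z | z ∈ C ∧ z.1 ∈ integerPoints p} h1 h2
    (a := 1 - ν / N) (b := ν / N) (sub_nonneg.2 (div_le_one_of_le₀ hN.le hN0.le))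
    (div_nonneg hν hN0.le) (by ring)
  have e : (1 - ν / N) • w + (ν / N) • (w + (N : ℝ) • r) = w + ν • r := by
    rw [smul_add, ← add_assoc, ← add_smul, sub_add_cancel, one_smul, smul_smul,
      div_mul_cancel₀ _ hN0.ne']
  rw [e] at h
  exact h

/-- The right-hand side of the system describing the fibre over an integer point. -/
def fibreRhs {m p : ℕ} (A : Matrix (Fin m) (Fin p) ℚ) (b : Fin m → ℚ) (u : Fin p → ℤ) :
    Fin m → ℚ :=
  fun k => b k - ∑ j, A k j * u j

theorem mem_fibre_iff {m p q : ℕ} (A : Matrix (Fin m) (Fin p) ℚ) (G : Matrix (Fin m) (Fin q) ℚ)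
    (b : Fin m → ℚ) (u : Fin p → ℤ) (y : Fin q → ℝ) (x : Fin 0 → ℝ) :
    (x, y) ∈ polyhedron (p := 0) (fun _ => 0) G (fibreRhs A b u) ↔
      ((fun j => (u j : ℝ), y) : MixedSpace p q) ∈ polyhedron A G b := by
  refine forall_congr' fun k => ?_
  simp only [linForm, fibreRhs, Finset.univ_eq_empty, Finset.sum_empty, zero_add]
  push_cast
  constructor <;> intro h <;> linarith

/-- A homogeneous generator of the fibre over `u`, as a homogeneous generator of the polyhedron. -/
def liftGen {p q : ℕ} (u : Fin p → ℤ) (g : (Fin 0 → ℚ) × (Fin q → ℚ)) (t : ℚ) :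
    (Fin p → ℚ) × (Fin q → ℚ) :=
  (fun j => t * u j, g.2)

theorem linFormQ_liftGen {p q : ℕ} (α : Fin p → ℚ) (β : Fin q → ℚ) (u : Fin p → ℤ)
    (g : (Fin 0 → ℚ) × (Fin q → ℚ)) (t : ℚ) :
    linFormQ α β (liftGen u g t) = t * (∑ j, α j * u j) + linFormQ (fun _ => 0) β g := by
  simp only [linFormQ, liftGen, Finset.univ_eq_empty, Finset.sum_empty, zero_add, Finset.mul_sum]
  congr 1
  exact Finset.sum_congr rfl fun j _ => by ring

/-- Subtracting integral multiples of the rays moves the mixed integer points into a bounded set. -/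
theorem exists_integral_reduction {p q : ℕ} {I : Type} [Fintype I]
    {g : I → (Fin p → ℚ) × (Fin q → ℚ)} {t : I → ℚ} (ht : ∀ i, 0 ≤ t i)
    (hint : ∀ i j, ∃ n : ℤ, (g i).1 j = n) :
    ∃ B : ℕ, ∀ z ∈ genSet g t, z.1 ∈ integerPoints p →
      ∃ (u : Fin p → ℤ) (y : Fin q → ℝ) (n : I → ℕ), (∀ j, |u j| ≤ B) ∧
        (∀ i, t i ≠ 0 → n i = 0) ∧ ((fun j => (u j : ℝ), y) : MixedSpace p q) ∈ genSet g t ∧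
        z = ((fun j => (u j : ℝ), y) : MixedSpace p q) + ∑ i, (n i : ℝ) • castPt (g i) := by
  classical
  -- Bounds for the coefficients left over: less than `1` for a ray after removing its floor, at
  -- most `1 / t i` otherwise because `∑ l i * t i = 1`.
  set κ : I → ℝ := fun i => if t i = 0 then 1 else (t i : ℝ)⁻¹ with hκ
  have hκ0 : ∀ i, 0 ≤ κ i := fun i => by
    simp only [hκ]
    split_ifs
    · exact zero_le_one
    · exact inv_nonneg.2 (by exact_mod_cast ht i)
  obtain ⟨B, hB⟩ := exists_nat_ge (∑ j, ∑ i, κ i * |(castPt (g i)).1 j|)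
  refine ⟨B, ?_⟩
  rintro _ ⟨l, hl, hl1, rfl⟩ hz
  set n : I → ℕ := fun i => if t i = 0 then ⌊l i⌋₊ else 0 with hn
  have hn0 : ∀ i, t i ≠ 0 → n i = 0 := fun i hi => by simp [hn, hi]
  have hle : ∀ i, 0 ≤ l i - n i ∧ l i - n i ≤ κ i := by
    intro i
    by_cases hi : t i = 0
    · simp only [hn, hκ, hi, if_true]
      constructor
      · exact sub_nonneg.2 (Nat.floor_le (hl i))
      · linarith [Nat.lt_floor_add_one (l i)]
    · simp only [hn, hκ, hi, if_false, Nat.cast_zero, sub_zero]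
      refine ⟨hl i, ?_⟩
      have hpos : (0 : ℝ) < t i := by exact_mod_cast lt_of_le_of_ne (ht i) (Ne.symm hi)
      rw [← one_div, le_div_iff₀ hpos, ← hl1]
      exact Finset.single_le_sum (f := fun i => l i * (t i : ℝ))
        (fun i _ => mul_nonneg (hl i) (by exact_mod_cast ht i)) (Finset.mem_univ i)
  have hmem : ∑ i, (l i - n i) • castPt (g i) ∈ genSet g t := by
    refine ⟨fun i => l i - n i, fun i => (hle i).1, ?_, rfl⟩
    rw [← hl1]
    refine Finset.sum_congr rfl fun i _ => ?_
    by_cases hi : t i = 0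
    · simp [hi]
    · simp [hn0 i hi]
  have hsplit : ∑ i, l i • castPt (g i)
      = ∑ i, (l i - n i) • castPt (g i) + ∑ i, (n i : ℝ) • castPt (g i) := by
    rw [← Finset.sum_add_distrib]
    exact Finset.sum_congr rfl fun i _ => by rw [← add_smul, sub_add_cancel]
  have hxint : (∑ i, (l i - n i) • castPt (g i)).1 ∈ integerPoints p := by
    have h1 : (∑ i, (l i - n i) • castPt (g i)).1
        = (∑ i, l i • castPt (g i)).1 + ∑ i, ((-(n i : ℤ) : ℤ) : ℝ) • (castPt (g i)).1 := by
      rw [hsplit, Prod.fst_add, Prod.fst_sum (f := fun i => (n i : ℝ) • castPt (g i)), add_assoc,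
        ← Finset.sum_add_distrib, Finset.sum_eq_zero (s := Finset.univ) (f := fun i =>
          ((n i : ℝ) • castPt (g i)).1 + ((-(n i : ℤ) : ℤ) : ℝ) • (castPt (g i)).1), add_zero]
      intro i _
      rw [Prod.smul_fst, ← add_smul]
      simp
    rw [h1]
    exact add_mem_integerPoints hz (sum_mem_integerPoints _ fun i _ =>
      int_smul_mem_integerPoints (castPt_mem_integerPoints (hint i)) _)
  obtain ⟨u, hu⟩ := hxint
  refine ⟨u, (∑ i, (l i - n i) • castPt (g i)).2, n, fun j => ?_, hn0, ?_, ?_⟩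
  · have h1 : (u j : ℝ) = ∑ i, (l i - n i) * (castPt (g i)).1 j := by
      have := congrFun hu j
      simpa [Prod.fst_sum, Finset.sum_apply] using this
    have h2 : |(u j : ℝ)| ≤ B := by
      rw [h1]
      refine (Finset.abs_sum_le_sum_abs _ _).trans (le_trans ?_ hB)
      refine le_trans (Finset.sum_le_sum fun i _ => ?_) (Finset.single_le_sum
        (f := fun j => ∑ i, κ i * |(castPt (g i)).1 j|) (fun j _ => Finset.sum_nonneg fun i _ =>
          mul_nonneg (hκ0 i) (abs_nonneg _)) (Finset.mem_univ j))
      rw [abs_mul, abs_of_nonneg (hle i).1]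
      exact mul_le_mul_of_nonneg_right (hle i).2 (abs_nonneg _)
    exact_mod_cast h2
  · rw [show (fun j => (u j : ℝ)) = _ from hu]
    exact hmem
  · rw [show (fun j => (u j : ℝ)) = _ from hu]
    exact hsplit

/-- **Meyer's theorem**: the mixed integer hull of a rational polyhedron is generated by finitely
many rational generators. -/
theorem mixedIntegerHull_generators {m p q : ℕ} (A : Matrix (Fin m) (Fin p) ℚ)
    (G : Matrix (Fin m) (Fin q) ℚ) (b : Fin m → ℚ) :
    ∃ (J : Type) (_ : Fintype J) (g : J → (Fin p → ℚ) × (Fin q → ℚ)) (t : J → ℚ),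
      (∀ j, 0 ≤ t j) ∧ mixedIntegerHull (polyhedron A G b) = genSet g t := by
  classical
  obtain ⟨I, hI, g, t, ht, hint, hgA, hP, -⟩ := polyhedron_generators A G b
  obtain ⟨B, hB⟩ := exists_integral_reduction ht hint
  choose F hF gF tF htF hintF hgF hPF hfarkas using
    fun u : Fin p → ℤ => polyhedron_generators (p := 0) (fun _ => 0) G (fibreRhs A b u)
  set X : Finset (Fin p → ℤ) := Fintype.piFinset fun _ => Finset.Icc (-(B : ℤ)) B with hX
  -- After the reduction only the integer points `u` of a finite box matter. The generators are
  -- those of the fibres over them, together with the integral rays of the polyhedron; other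
  -- generators of the polyhedron are replaced by `0`.
  refine ⟨(Σ u : X, F u) ⊕ I, inferInstance,
    Sum.elim (fun e => liftGen e.1.1 (gF e.1.1 e.2) (tF e.1.1 e.2))
      (fun i => if t i = 0 then g i else 0),
    Sum.elim (fun e => tF e.1.1 e.2) (fun _ => 0), ?_, ?_⟩
  · rintro (e | i)
    · exact htF _ _
    · exact le_rfl
  refine Set.Subset.antisymm (convexHull_min ?_ convex_genSet) (genSet_subset
    (convex_convexHull ℝ _) ?_ ?_ ?_)
  · rintro z ⟨hz, hzi⟩
    obtain ⟨u, y, n, hu, hn, huy, rfl⟩ := hB z (hP ▸ hz) hzi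
    rw [← hP, ← mem_fibre_iff A G b u y 0, hPF u] at huy
    obtain ⟨l, hl, hl1, hly⟩ := huy
    have huX : u ∈ X := by
      rw [hX, Fintype.mem_piFinset]
      exact fun j => Finset.mem_Icc.2 (abs_le.1 (hu j))
    set L : (v : X) → F v → ℝ := Pi.single ⟨u, huX⟩ l with hL
    have hsum : ∀ {M : Type} [AddCommMonoid M] [Module ℝ M] (f : (v : X) → F v → M),
        ∑ e : Σ v : X, F v, L e.1 e.2 • f e.1 e.2 = ∑ e, l e • f ⟨u, huX⟩ e := by
      intro M _ _ f
      rw [Fintype.sum_sigma, Finset.sum_eq_single ⟨u, huX⟩]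
      · simp [hL]
      · intro v _ hv
        simp [hL, Pi.single_eq_of_ne hv]
      · simp
    refine ⟨Sum.elim (fun e => L e.1 e.2) (fun i => (n i : ℝ)), ?_, ?_, ?_⟩
    · rintro (⟨v, e⟩ | i)
      · by_cases hv : v = ⟨u, huX⟩
        · subst hv
          simpa [hL] using hl e
        · simp [hL, Pi.single_eq_of_ne hv]
      · exact Nat.cast_nonneg _
    · rw [Fintype.sum_sum_type]
      simp only [Sum.elim_inl, Sum.elim_inr, Rat.cast_zero, mul_zero, Finset.sum_const_zero,
        add_zero]
      exact (hsum fun v e => (tF v e : ℝ)).trans hl1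
    · rw [Fintype.sum_sum_type]
      simp only [Sum.elim_inl, Sum.elim_inr]
      congr 1
      · refine (hsum fun v e => castPt (liftGen v.1 (gF v e) (tF v e))).trans ?_
        refine Prod.ext ?_ ?_
        · funext j
          simp only [Prod.fst_sum, Prod.smul_fst, Finset.sum_apply, Pi.smul_apply, castPt, liftGen,
            smul_eq_mul]
          push_cast
          simp_rw [← mul_assoc]
          rw [← Finset.sum_mul]
          rw [hl1, one_mul]
        · rw [← congrArg Prod.snd hly]
          simp only [Prod.snd_sum, Prod.smul_snd, castPt, liftGen]
      · refine Finset.sum_congr rfl fun i _ => ?_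
        by_cases hi : t i = 0
        · simp [hi]
        · simp [hn i hi]
  · rintro (e | i)
    · exact htF _ _
    · exact le_rfl
  · rintro (⟨v, e⟩ | i) hpos
    · simp only [Sum.elim_inl] at hpos ⊢
      refine subset_convexHull ℝ _ ?_
      have h1 := inv_smul_mem_genSet (g := gF v) hpos
      rw [← hPF, ← Prod.mk.eta (p := (tF v e : ℝ)⁻¹ • castPt (gF v e)), mem_fibre_iff] at h1
      have hne : (tF v e : ℝ) ≠ 0 := by exact_mod_cast hpos.ne'
      have h2 : (tF v e : ℝ)⁻¹ • castPt (liftGen v.1 (gF v e) (tF v e))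
          = ((fun j => ((v.1 j : ℤ) : ℝ), ((tF v e : ℝ)⁻¹ • castPt (gF v e)).2) :
              MixedSpace p q) := by
        refine Prod.ext ?_ rfl
        funext j
        simp [castPt, liftGen, hne]
      rw [h2]
      exact ⟨h1, v.1, rfl⟩
    · exact absurd hpos (lt_irrefl _)
  · rintro (⟨v, e⟩ | i) h0 z hz r hr
    · simp only [Sum.elim_inl] at h0 ⊢
      refine add_smul_mem_mixedIntegerHull ⟨0, ?_⟩ (fun w hw n k => ?_) hz hr
      · funext j
        simp [castPt, liftGen, h0]
      · rw [linForm_add, linForm_smul, linForm_castPt, linFormQ_liftGen, h0, zero_mul, zero_add]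
        have h1 := hgF v e k
        rw [h0, mul_zero] at h1
        have h2 : ((linFormQ (fun _ => 0) (G k) (gF v e) : ℚ) : ℝ) ≤ 0 := by exact_mod_cast h1
        have := hw k
        nlinarith [mul_nonneg (Nat.cast_nonneg (α := ℝ) n) (neg_nonneg.2 h2)]
    · simp only [Sum.elim_inr]
      split_ifs with hi
      · refine add_smul_mem_mixedIntegerHull (castPt_mem_integerPoints (hint i))
          (fun w hw n => ?_) hz hr
        rw [hP] at hw ⊢
        exact add_smul_mem_genSet hw hi (Nat.cast_nonneg n)
      · have : castPt (0 : (Fin p → ℚ) × (Fin q → ℚ)) = 0 := by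
          refine Prod.ext ?_ ?_ <;> funext j <;> simp [castPt]
        rw [this, smul_zero, add_zero]
        exact hz

/-! ### Translation to integer points. -/

/-- A real point on which all integral functionals orthogonal to the integer vectors `r i` are
integral can be moved to an integer point within the span of the `r i`. -/
theorem exists_integer_translate {p : ℕ} {I : Type} [Fintype I] (r : I → Fin p → ℤ)
    (x : Fin p → ℝ)
    (hx : ∀ d : Fin p → ℤ, (∀ i, ∑ j, d j * r i j = 0) → ∃ n : ℤ, ∑ j, (d j : ℝ) * x j = n) :
    ∃ μ : I → ℝ, (fun j => x j + ∑ i, μ i * (r i j : ℝ)) ∈ integerPoints p := by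
  classical
  let N : Submodule ℤ (Fin p → ℤ) := Submodule.span ℤ (Set.range r)
  let T : Submodule ℤ ((Fin p → ℤ) ⧸ N) := Submodule.torsion ℤ ((Fin p → ℤ) ⧸ N)
  let F := ((Fin p → ℤ) ⧸ N) ⧸ T
  let π : (Fin p → ℤ) →ₗ[ℤ] F := T.mkQ ∘ₗ N.mkQ
  have hπ : Function.Surjective π := (T.mkQ_surjective).comp N.mkQ_surjective
  have : Module.IsTorsionFree ℤ F := 
    Submodule.QuotientTorsion.instIsTorsionFree
  have : Module.Finite ℤ F := inferInstanceAs (Module.Finite ℤ (((Fin p → ℤ) ⧸ N) ⧸ T))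
  -- Freeness of the torsion-free quotient `F` gives integral coordinate functionals `d k` vanishing
  -- on the `r i`, and lifts `e k` of its basis.
  have : Module.Free ℤ F := Module.free_of_finite_type_torsion_free'
  let f := Module.finBasis ℤ F
  choose e he using fun k => hπ (f k)
  let E : Fin p → Fin p → ℤ := fun j => Pi.single j 1
  let d : Fin (Module.finrank ℤ F) → Fin p → ℤ := fun k j => f.coord k (π (E j))
  have hd : ∀ k (v : Fin p → ℤ), ∑ j, d k j * v j = f.coord k (π v) := by
    intro k v
    have hv : v = ∑ j, v j • E j := by
      funext i
      simp [E, Finset.sum_apply, Pi.single_apply]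
    conv_rhs => rw [hv]
    simp only [map_sum, map_smul, smul_eq_mul, d]
    exact Finset.sum_congr rfl fun j _ => mul_comm _ _
  choose M hM using fun k => hx (d k) fun i => by
    rw [hd]
    have : N.mkQ (r i) = 0 := by
      rw [Submodule.mkQ_apply, Submodule.Quotient.mk_eq_zero]
      exact Submodule.subset_span ⟨i, rfl⟩
    simp [π, this]
  -- `n j` is the part of the unit vector `E j` killed by `π`; some nonzero multiple of it lies in
  -- the lattice spanned by the `r i`.
  let n : Fin p → Fin p → ℤ := fun j => E j - ∑ k, d k j • e k
  have hn : ∀ j, ∃ (m : ℤ) (c : I → ℤ), m ≠ 0 ∧ m • n j = ∑ i, c i • r i := by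
    intro j
    have h1 : π (n j) = 0 := by
      simp only [n, map_sub, map_sum, map_smul, he]
      exact sub_eq_zero.2 (f.sum_repr (π (E j))).symm
    have h2 : N.mkQ (n j) ∈ T := by
      rw [← Submodule.ker_mkQ T]
      exact h1
    obtain ⟨m, hm⟩ := (Submodule.mem_torsion_iff _).1 h2
    have h3 : (m : ℤ) • n j ∈ N := by
      rw [← Submodule.ker_mkQ N, LinearMap.mem_ker, map_smul]
      exact hm
    obtain ⟨c, hc⟩ := (Submodule.mem_span_range_iff_exists_fun ℤ).1 h3
    exact ⟨m, c, nonZeroDivisors.coe_ne_zero m, hc.symm⟩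
  choose m c hm hc using hn
  -- Subtracting `∑ x j • n j`, a real combination of the `r i`, leaves `∑ M k • e k`, which is
  -- integral.
  refine ⟨fun i => -∑ j, x j * (c j i / m j), fun l => ∑ k, M k * e k l, ?_⟩
  funext l
  have h1 : ∀ j, (n j l : ℝ) = ∑ i, (c j i / m j : ℝ) * r i l := by
    intro j
    have h := congrFun (hc j) l
    simp only [Pi.smul_apply, Finset.sum_apply, smul_eq_mul] at h
    have h' : (m j : ℝ) * n j l = ∑ i, (c j i : ℝ) * r i l := by exact_mod_cast h
    have hm' : (m j : ℝ) ≠ 0 := by exact_mod_cast hm j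
    rw [eq_comm, ← mul_right_inj' hm', h', Finset.mul_sum]
    exact Finset.sum_congr rfl fun i _ => by field_simp
  have h2 : ∑ j, x j * (n j l : ℝ) = x l - ∑ k, (M k : ℝ) * e k l := by
    have h3 : ∀ j, (n j l : ℝ) = (if l = j then 1 else 0) - ∑ k, (d k j : ℝ) * e k l := by
      intro j
      simp [n, E, Pi.single_apply, Finset.sum_apply]
    simp_rw [h3, mul_sub, Finset.sum_sub_distrib, Finset.mul_sum]
    congr 1
    · simp
    · rw [Finset.sum_comm]
      refine Finset.sum_congr rfl fun k _ => ?_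
      rw [← hM k, Finset.sum_mul]
      exact Finset.sum_congr rfl fun j _ => by ring
  have h4 : ∑ i, (-∑ j, x j * (c j i / m j : ℝ)) * r i l = -∑ j, x j * (n j l : ℝ) := by
    simp_rw [h1, neg_mul, Finset.sum_neg_distrib, Finset.mul_sum, Finset.sum_mul]
    rw [Finset.sum_comm]
    congr 1
    exact Finset.sum_congr rfl fun i _ => Finset.sum_congr rfl fun j _ => by ring
  rw [h4, h2]
  push_cast
  ring

/-! ### Compactness and disjunctive rules. -/

/-- The pairing of a rational functional with a real vector. -/
def ratPair {s : ℕ} (v : Fin s → ℚ) (ω : Fin s → ℝ) : ℝ := ∑ j, (v j : ℝ) * ω j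

theorem continuous_ratPair {s : ℕ} (v : Fin s → ℚ) : Continuous (ratPair v) := by
  unfold ratPair
  fun_prop

theorem ratPair_smul {s : ℕ} (v : Fin s → ℚ) (r : ℝ) (ω : Fin s → ℝ) :
    ratPair v (r • ω) = r * ratPair v ω := by
  simp only [ratPair, Pi.smul_apply, smul_eq_mul, Finset.mul_sum]
  exact Finset.sum_congr rfl fun j _ => by ring

theorem ratPair_add {s : ℕ} (v : Fin s → ℚ) (ω ω' : Fin s → ℝ) :
    ratPair v (ω + ω') = ratPair v ω + ratPair v ω' := by
  simp only [ratPair, Pi.add_apply, mul_add, Finset.sum_add_distrib]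

theorem convex_ratPair_nonneg {s : ℕ} (v : Fin s → ℚ) : Convex ℝ {ω | 0 ≤ ratPair v ω} :=
  convex_halfSpace_ge ⟨ratPair_add v, fun r ω => ratPair_smul v r ω⟩ 0

/-- Rational strict separation of a point from a compact convex set inside the affine hyperplane
on which a linear form has the value `1`. -/
theorem exists_rat_separating {s : ℕ} {S : Set (Fin s → ℝ)} (hS : IsCompact S)
    (hSc : Convex ℝ S) {ω : Fin s → ℝ} (hω : ω ∉ S) (e : Fin s → ℚ)
    (he : ∀ x ∈ insert ω S, ratPair e x = 1) :
    ∃ v : Fin s → ℚ, ratPair v ω < 0 ∧ ∀ x ∈ S, 0 < ratPair v x := by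
  obtain ⟨f, u, w, hu, huw, hw⟩ := geometric_hahn_banach_compact_closed (convex_singleton ω)
    isCompact_singleton hSc hS.isClosed (Set.disjoint_singleton_left.2 hω)
  have hf : ∀ x, f x = ∑ j, f (Pi.single j 1) * x j := fun x => by
    have := LinearMap.pi_apply_eq_sum_univ (f : (Fin s → ℝ) →ₗ[ℝ] ℝ) x
    rw [ContinuousLinearMap.coe_coe] at this
    rw [this]
    refine Finset.sum_congr rfl fun j _ => ?_
    rw [smul_eq_mul, mul_comm]
    congr 2
    ext i
    simp [Pi.single_apply, eq_comm]
  -- On the hyperplane where `e` equals `1`, subtracting a multiple of `e` centres the separation at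
  -- `0`; it then survives a small rational perturbation of the coefficients.
  set r : Fin s → ℝ := fun j => f (Pi.single j 1) - (u + w) / 2 * e j with hr
  have hrx : ∀ x ∈ insert ω S, ∑ j, r j * x j = f x - (u + w) / 2 := by
    intro x hx
    have h1 := he x hx
    simp only [hr, sub_mul, Finset.sum_sub_distrib, ← hf, mul_assoc, ← Finset.mul_sum]
    rw [show ∑ j, (e j : ℝ) * x j = 1 from h1, mul_one]
  obtain ⟨B, hB⟩ := (hS.insert ω).isBounded.exists_norm_le
  have hB0 : 0 ≤ B := (norm_nonneg _).trans (hB ω (Set.mem_insert _ _))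
  set ε : ℝ := (w - u) / 2 / ((s + 1) * (B + 1)) with hε
  have hε0 : 0 < ε := by
    have : 0 < w - u := sub_pos.2 huw
    positivity
  choose v hv1 hv2 using fun j => exists_rat_btwn (show r j < r j + ε by linarith)
  have hclose : ∀ x ∈ insert ω S, |ratPair v x - ∑ j, r j * x j| < (w - u) / 2 := by
    intro x hx
    rw [ratPair, ← Finset.sum_sub_distrib]
    calc |∑ j, ((v j : ℝ) * x j - r j * x j)| ≤ ∑ j : Fin s, ε * B := by
          refine (Finset.abs_sum_le_sum_abs _ _).trans (Finset.sum_le_sum fun j _ => ?_)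
          rw [← sub_mul, abs_mul]
          refine mul_le_mul ?_ ((norm_le_pi_norm x j).trans (hB x hx)) (abs_nonneg _) hε0.le
          rw [abs_of_pos (sub_pos.2 (hv1 j))]
          linarith [hv2 j]
      _ = s * (ε * B) := by simp
      _ < (s + 1) * (ε * (B + 1)) := by
          nlinarith [mul_nonneg (Nat.cast_nonneg (α := ℝ) s) hε0.le, mul_nonneg hε0.le hB0]
      _ = (w - u) / 2 := by
          rw [hε]
          have : (s + 1 : ℝ) ≠ 0 := by positivity
          have : (B + 1 : ℝ) ≠ 0 := by positivity
          field_simp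
  refine ⟨v, ?_, fun x hx => ?_⟩
  · have h1 := hclose ω (Set.mem_insert _ _)
    rw [hrx ω (Set.mem_insert _ _)] at h1
    have := hu ω rfl
    linarith [(abs_lt.1 h1).2]
  · have h1 := hclose x (Set.mem_insert_of_mem _ hx)
    rw [hrx x (Set.mem_insert_of_mem _ hx)] at h1
    have := hw x hx
    linarith [(abs_lt.1 h1).1]

theorem isCompact_convexJoin {s : ℕ} {D D' : Set (Fin s → ℝ)} (hD : IsCompact D)
    (hD' : IsCompact D') : IsCompact (convexJoin ℝ D D') := by
  have : convexJoin ℝ D D' = (fun a : ℝ × (Fin s → ℝ) × (Fin s → ℝ) =>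
      (1 - a.1) • a.2.1 + a.1 • a.2.2) '' (Set.Icc 0 1 ×ˢ D ×ˢ D') := by
    ext x
    simp only [mem_convexJoin, segment_eq_image, Set.mem_image, Set.mem_prod, Prod.exists]
    constructor
    · rintro ⟨a, ha, b, hb, θ, hθ, rfl⟩
      exact ⟨θ, a, b, ⟨hθ, ha, hb⟩, rfl⟩
    · rintro ⟨θ, a, b, ⟨hθ, ha, hb⟩, rfl⟩
      exact ⟨a, ha, b, hb, θ, hθ, rfl⟩
  rw [this]
  exact (isCompact_Icc.prod (hD.prod hD')).image (by fun_prop)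

/-- An extreme point outside two compact convex subsets is outside a compact convex set containing
both. -/
theorem exists_compact_convex_superset {s : ℕ} {Ω D D' : Set (Fin s → ℝ)} {ω : Fin s → ℝ}
    (hω : ω ∈ Ω.extremePoints ℝ) (hD : IsCompact D) (hD' : IsCompact D') (hDc : Convex ℝ D)
    (hDc' : Convex ℝ D') (hDs : D ⊆ Ω) (hDs' : D' ⊆ Ω) (hωD : ω ∉ D) (hωD' : ω ∉ D')
    (hΩ : Convex ℝ Ω) :
    ∃ S, IsCompact S ∧ Convex ℝ S ∧ ω ∉ S ∧ D ⊆ S ∧ D' ⊆ S ∧ S ⊆ Ω := by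
  rcases D.eq_empty_or_nonempty with rfl | hne
  · exact ⟨D', hD', hDc', hωD', Set.empty_subset _, subset_rfl, hDs'⟩
  rcases D'.eq_empty_or_nonempty with rfl | hne'
  · exact ⟨D, hD, hDc, hωD, subset_rfl, Set.empty_subset _, hDs⟩
  refine ⟨convexJoin ℝ D D', isCompact_convexJoin hD hD', hDc.convexJoin hDc', fun h => ?_,
    subset_convexJoin_left hne', subset_convexJoin_right hne, convexJoin_subset hDs hDs' hΩ⟩
  obtain ⟨a, ha, b, hb, hab⟩ := mem_convexJoin.1 h
  rcases (mem_extremePoints_iff_forall_segment.1 hω).2 a (hDs ha) b (hDs' hb) hab with h | h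
  · exact hωD (h ▸ ha)
  · exact hωD' (h ▸ hb)

/-- If a rational functional `v₀` is not eventually nonnegative on a decreasing sequence of sets
whose eventually nonnegative functionals are closed under a family of disjunctive rules, then some
normalised evaluation is nonpositive at `v₀` and satisfies all disjunctions of the family. -/
theorem exists_evaluation_of_not_derivable {X : Type} {s : ℕ} {C : ℕ → Set X} (hC : Antitone C)
    (φ : X → Fin s → ℝ) {K : Set (Fin s → ℝ)} (hK : IsCompact K) (hKc : Convex ℝ K)
    (e : Fin s → ℚ) (heK : ∀ ω ∈ K, ratPair e ω = 1) (he : ∀ x ∈ C 0, 0 < ratPair e (φ x))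
    (hφ : ∀ x ∈ C 0, (ratPair e (φ x))⁻¹ • φ x ∈ K)
    (R : Set ((Fin s → ℚ) × (Fin s → ℚ)))
    (hR : ∀ a ∈ R, ∀ v : Fin s → ℚ, (∃ n, ∀ x ∈ C n,
      0 ≤ ratPair a.1 (φ x) ∨ 0 ≤ ratPair a.2 (φ x) → 0 ≤ ratPair v (φ x)) →
        ∃ n, ∀ x ∈ C n, 0 ≤ ratPair v (φ x))
    (v₀ : Fin s → ℚ) (hv₀ : ∀ n, ∃ x ∈ C n, ratPair v₀ (φ x) < 0) :
    ∃ ω ∈ K, ratPair v₀ ω ≤ 0 ∧ ∀ a ∈ R, 0 ≤ ratPair a.1 ω ∨ 0 ≤ ratPair a.2 ω := by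
  -- `Ω` consists of the normalised evaluations satisfying everything eventually valid. By
  -- compactness, limits of normalised points of `C n` land in it.
  set Ω : Set (Fin s → ℝ) := K ∩ ⋂ v ∈ {v : Fin s → ℚ | ∃ n, ∀ x ∈ C n, 0 ≤ ratPair v (φ x)},
    {ω | 0 ≤ ratPair v ω} with hΩ
  have hΩcl : ∀ v : Fin s → ℚ, IsClosed {ω | 0 ≤ ratPair v ω} := fun v =>
    isClosed_le continuous_const (continuous_ratPair v)
  have hΩcpt : IsCompact Ω := hK.inter_right (isClosed_biInter fun v _ => hΩcl v)
  have hΩconv : Convex ℝ Ω := hKc.inter (convex_iInter₂ fun v _ => convex_ratPair_nonneg v)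
  have hC0 : ∀ n, C n ⊆ C 0 := fun n => hC (Nat.zero_le n)
  have hnorm : ∀ (v : Fin s → ℚ), ∀ x ∈ C 0, (0 ≤ ratPair v ((ratPair e (φ x))⁻¹ • φ x) ↔
      0 ≤ ratPair v (φ x)) := by
    intro v x hx
    rw [ratPair_smul]
    exact mul_nonneg_iff_of_pos_left (inv_pos.2 (he x hx))
  have hcluster : ∀ S : Set (Fin s → ℝ), IsClosed S →
      (∀ n, ∃ x ∈ C n, (ratPair e (φ x))⁻¹ • φ x ∈ S) → (Ω ∩ S).Nonempty := by
    intro S hS h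
    choose x hxC hxS using h
    obtain ⟨ω, hω, ψ, hψ, hlim⟩ := hK.tendsto_subseq
      (x := fun n => (ratPair e (φ (x n)))⁻¹ • φ (x n))
      fun n => hφ (x n) (hC0 n (hxC n))
    refine ⟨ω, ⟨hω, Set.mem_iInter₂.2 fun v ⟨n, hn⟩ => ?_⟩,
      hS.mem_of_tendsto hlim (Filter.Eventually.of_forall fun n => hxS _)⟩
    refine (hΩcl v).mem_of_tendsto hlim (Filter.eventually_atTop.2 ⟨n, fun k hk => ?_⟩)
    have hmem : x (ψ k) ∈ C (ψ k) := hxC _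
    exact (hnorm v _ (hC0 _ hmem)).2 (hn _ (hC (hk.trans (hψ.id_le k)) hmem))
  obtain ⟨ω₀, hω₀, hω₀v⟩ := hcluster {ω | ratPair v₀ ω ≤ 0}
    (isClosed_le (continuous_ratPair v₀) continuous_const) fun n => by
      obtain ⟨x, hx, hxv⟩ := hv₀ n
      refine ⟨x, hx, ?_⟩
      change ratPair v₀ _ ≤ 0
      rw [ratPair_smul]
      exact mul_nonpos_of_nonneg_of_nonpos (inv_nonneg.2 (he x (hC0 n hx)).le) hxv.le
  -- An extreme point of the face of `Ω` minimising `v₀` is extreme in `Ω` and still has `v₀ ≤ 0`.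
  let L : StrongDual ℝ (Fin s → ℝ) :=
    { toFun := fun ω => -ratPair v₀ ω
      map_add' := fun ω ω' => by rw [ratPair_add]; ring
      map_smul' := fun r ω => by rw [ratPair_smul]; simp
      cont := (continuous_ratPair v₀).neg }
  have hexp : IsExposed ℝ Ω (L.toExposed Ω) := ContinuousLinearMap.toExposed.isExposed
  have hne : (L.toExposed Ω).Nonempty := by
    obtain ⟨ω, hω, hmax⟩ := hΩcpt.exists_isMaxOn ⟨ω₀, hω₀⟩ L.continuous.continuousOn
    exact ⟨ω, hω, fun y hy => hmax hy⟩
  obtain ⟨ω, hωe⟩ := (hexp.isCompact hΩcpt).extremePoints_nonempty hne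
  have hωF := hωe.1
  have hωΩ : ω ∈ Ω.extremePoints ℝ := hexp.isExtreme.extremePoints_subset_extremePoints hωe
  refine ⟨ω, hωF.1.1, ?_, fun a ha => ?_⟩
  · have := hωF.2 ω₀ hω₀
    change -ratPair v₀ ω₀ ≤ -ratPair v₀ ω at this
    have h2 : ratPair v₀ ω₀ ≤ 0 := hω₀v
    linarith
  · by_contra hcon
    push Not at hcon
    -- If `ω` failed both sides of a disjunction, extremality would keep it out of the convex join
    -- of the two parts of `Ω`. A separating functional `v` is then eventually nonnegative on each
    -- side, hence by the rule eventually nonnegative, contradicting `v ω < 0`.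
    obtain ⟨S, hS, hSc, hωS, hS1, hS2, hSΩ⟩ := exists_compact_convex_superset hωΩ
      (hΩcpt.inter_right (hΩcl a.1)) (hΩcpt.inter_right (hΩcl a.2))
      (hΩconv.inter (convex_ratPair_nonneg a.1)) (hΩconv.inter (convex_ratPair_nonneg a.2))
      Set.inter_subset_left Set.inter_subset_left (fun h => not_lt.2 h.2 hcon.1)
      (fun h => not_lt.2 h.2 hcon.2) hΩconv
    obtain ⟨v, hvω, hvS⟩ := exists_rat_separating hS hSc hωS e (by
      rintro x (rfl | hx)
      · exact heK _ hωF.1.1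
      · exact heK _ (hSΩ hx).1)
    have hside : ∀ b : Fin s → ℚ, Ω ∩ {ω | 0 ≤ ratPair b ω} ⊆ S →
        ∃ n, ∀ x ∈ C n, 0 ≤ ratPair b (φ x) → 0 ≤ ratPair v (φ x) := by
      intro b hb
      by_contra hno
      push Not at hno
      obtain ⟨y, hyΩ, hy1, hy2⟩ := hcluster ({ω | 0 ≤ ratPair b ω} ∩ {ω | ratPair v ω ≤ 0})
        ((hΩcl b).inter (isClosed_le (continuous_ratPair v) continuous_const)) fun n => by
          obtain ⟨x, hx, hx1, hx2⟩ := hno n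
          refine ⟨x, hx, (hnorm b x (hC0 n hx)).2 hx1, ?_⟩
          change ratPair v _ ≤ 0
          rw [ratPair_smul]
          exact mul_nonpos_of_nonneg_of_nonpos (inv_nonneg.2 (he x (hC0 n hx)).le) hx2.le
      exact absurd (hvS y (hb ⟨hyΩ, hy1⟩)) (not_lt.2 hy2)
    obtain ⟨n₁, hn₁⟩ := hside a.1 hS1
    obtain ⟨n₂, hn₂⟩ := hside a.2 hS2
    have hder := hR a ha v ⟨max n₁ n₂, fun x hx h => h.elim
      (hn₁ x (hC (le_max_left _ _) hx)) (hn₂ x (hC (le_max_right _ _) hx))⟩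
    have : 0 ≤ ratPair v ω := Set.mem_iInter₂.1 hωF.1.2 v hder
    linarith

/-! ### Slacks and inequalities strict at the mixed integer points. -/

/-- A rational inequality `α x + β y ≤ γ`, stored as `((α, β), γ)`. -/
abbrev RatIneq (p q : ℕ) : Type := ((Fin p → ℚ) × (Fin q → ℚ)) × ℚ

/-- The slack of a rational inequality at a homogeneous rational generator. -/
def slackQ {p q : ℕ} (g : (Fin p → ℚ) × (Fin q → ℚ)) (t : ℚ) : RatIneq p q →ₗ[ℚ] ℚ where
  toFun e := e.2 * t - linFormQ e.1.1 e.1.2 g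
  map_add' e e' := by
    simp only [linFormQ, Prod.fst_add, Prod.snd_add, Pi.add_apply, add_mul,
      Finset.sum_add_distrib]
    ring
  map_smul' r e := by
    simp only [linFormQ, Prod.smul_fst, Prod.smul_snd, Pi.smul_apply, smul_eq_mul, mul_assoc,
      ← Finset.mul_sum, RingHom.id_apply]
    ring

/-- The slack of a rational inequality at a real point. -/
def slack {p q : ℕ} (z : MixedSpace p q) : RatIneq p q →ₗ[ℚ] ℝ where
  toFun e := (e.2 : ℝ) - linForm e.1.1 e.1.2 z
  map_add' e e' := by
    simp only [linForm, Prod.fst_add, Prod.snd_add, Pi.add_apply, Rat.cast_add, add_mul,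
      Finset.sum_add_distrib]
    ring
  map_smul' r e := by
    simp only [linForm, Prod.smul_fst, Prod.smul_snd, Pi.smul_apply, smul_eq_mul, Rat.cast_mul,
      mul_assoc, ← Finset.mul_sum, RingHom.id_apply, Rat.smul_def]
    ring

theorem slackQ_apply {p q : ℕ} (g : (Fin p → ℚ) × (Fin q → ℚ)) (t : ℚ) (e : RatIneq p q) :
    slackQ g t e = e.2 * t - linFormQ e.1.1 e.1.2 g := rfl

theorem slack_apply {p q : ℕ} (z : MixedSpace p q) (e : RatIneq p q) :
    slack z e = (e.2 : ℝ) - linForm e.1.1 e.1.2 z := rfl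

theorem slack_sum {p q : ℕ} {I : Type} [Fintype I] (g : I → (Fin p → ℚ) × (Fin q → ℚ))
    (t : I → ℚ) (l : I → ℝ) (hl : ∑ i, l i * (t i : ℝ) = 1) (e : RatIneq p q) :
    slack (∑ i, l i • castPt (g i)) e = ∑ i, l i * (slackQ (g i) (t i) e : ℝ) := by
  have h1 : linForm e.1.1 e.1.2 (∑ i, l i • castPt (g i))
      = ∑ i, l i * (linFormQ e.1.1 e.1.2 (g i) : ℝ) := by
    rw [← linFormₗ_apply, map_sum]
    exact Finset.sum_congr rfl fun i _ => by
      rw [map_smul, smul_eq_mul, linFormₗ_apply, linForm_castPt]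
  rw [slack_apply, h1, ← mul_one (e.2 : ℝ), ← hl, Finset.mul_sum, ← Finset.sum_sub_distrib]
  refine Finset.sum_congr rfl fun i _ => ?_
  rw [slackQ_apply]
  push_cast
  ring

theorem ratPair_linearMap {V : Type} [AddCommGroup V] [Module ℚ V] {s : ℕ} (f : V →ₗ[ℚ] ℝ)
    (a : Fin s → V) (v : Fin s → ℚ) : ratPair v (fun j => f (a j)) = f (∑ j, v j • a j) := by
  rw [map_sum, ratPair]
  exact Finset.sum_congr rfl fun j _ => by rw [map_smul, Rat.smul_def]

/-- The inequality `d x ≤ δ` on the integer variables. -/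
def intIneq {p : ℕ} (q : ℕ) (d : Fin p → ℤ) (δ : ℤ) : RatIneq p q :=
  ((fun j => (d j : ℚ), 0), (δ : ℚ))

theorem slack_intIneq {p q : ℕ} (d : Fin p → ℤ) (δ : ℤ) (z : MixedSpace p q) :
    slack z (intIneq q d δ) = δ - ∑ j, (d j : ℝ) * z.1 j := by
  simp [slack_apply, intIneq, linForm]

/-- Coordinates of weight zero are forced to vanish; the others are at most `1 / w i`. -/
theorem isCompact_weightedSimplex {I : Type} [Fintype I] (w : I → ℝ) (hw : ∀ i, 0 ≤ w i) :
    IsCompact {l : I → ℝ | (∀ i, 0 ≤ l i) ∧ (∀ i, w i = 0 → l i = 0) ∧ ∑ i, l i * w i = 1} := by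
  have hcl : IsClosed {l : I → ℝ | (∀ i, w i = 0 → l i = 0) ∧ ∑ i, l i * w i = 1} := by
    refine IsClosed.inter (s₁ := {l : I → ℝ | ∀ i, w i = 0 → l i = 0}) ?_
      (isClosed_eq (by fun_prop) continuous_const)
    have : {l : I → ℝ | ∀ i, w i = 0 → l i = 0} = ⋂ i, ⋂ (_ : w i = 0), {l | l i = 0} := by
      ext l; simp
    rw [this]
    exact isClosed_iInter fun i => isClosed_iInter fun _ =>
      isClosed_eq (continuous_apply i) continuous_const
  refine ((isCompact_Icc (a := (0 : I → ℝ)) (b := fun i => (w i)⁻¹)).inter_right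
    hcl).of_isClosed_subset ?_ ?_
  · have : {l : I → ℝ | (∀ i, 0 ≤ l i) ∧ (∀ i, w i = 0 → l i = 0) ∧ ∑ i, l i * w i = 1}
        = Set.Ici 0 ∩ {l : I → ℝ | (∀ i, w i = 0 → l i = 0) ∧ ∑ i, l i * w i = 1} := rfl
    rw [this]
    exact isClosed_Ici.inter hcl
  · rintro l ⟨h0, h1, h2⟩
    refine ⟨⟨h0, fun i => ?_⟩, h1, h2⟩
    rcases (hw i).eq_or_lt with hi | hi
    · rw [h1 i hi.symm]
      exact inv_nonneg.2 (hw i)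
    · change l i ≤ (w i)⁻¹
      rw [← one_div, le_div_iff₀ hi, ← h2]
      exact Finset.single_le_sum (f := fun i => l i * w i)
        (fun i _ => mul_nonneg (h0 i) (hw i)) (Finset.mem_univ i)

theorem convex_weightedSimplex {I : Type} [Fintype I] (w : I → ℝ) :
    Convex ℝ {l : I → ℝ | (∀ i, 0 ≤ l i) ∧ (∀ i, w i = 0 → l i = 0) ∧ ∑ i, l i * w i = 1} := by
  rintro l ⟨h0, h1, h2⟩ l' ⟨h0', h1', h2'⟩ a b ha hb hab
  refine ⟨fun i => add_nonneg (mul_nonneg ha (h0 i)) (mul_nonneg hb (h0' i)), fun i hi => ?_, ?_⟩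
  · simp [h1 i hi, h1' i hi]
  · simp only [Pi.add_apply, Pi.smul_apply, smul_eq_mul, add_mul, mul_assoc,
      Finset.sum_add_distrib, ← Finset.mul_sum, h2, h2', mul_one, hab]

/-- A rational inequality that is bounded on the recession cone and satisfied strictly by all mixed
integer points is derivable with split cuts. -/
theorem derivable_of_forall_integer_lt {p q k : ℕ} (hk : 2 ≤ k) {I : Type} [Fintype I]
    {g : I → (Fin p → ℚ) × (Fin q → ℚ)} {t : I → ℚ} (ht : ∀ i, 0 ≤ t i)
    (hint : ∀ i j, ∃ n : ℤ, (g i).1 j = n) {c : Fin p → ℚ} {h : Fin q → ℚ} {γ : ℚ}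
    (hray : ∀ i, t i = 0 → linFormQ c h (g i) ≤ 0)
    (hno : ∀ z ∈ genSet g t, z.1 ∈ integerPoints p → linForm c h z < γ) :
    Derivable k (genSet g t) c h γ := by
  classical
  by_contra hnd
  obtain ⟨g₀, hg₀γ, hg₀⟩ : ∃ g₀ : ℚ, γ ≤ g₀ ∧ ∀ i, linFormQ c h (g i) ≤ g₀ * t i := by
    refine ⟨|γ| + ∑ i, |linFormQ c h (g i) / t i|, ?_, fun i => ?_⟩
    · exact (le_abs_self γ).trans
        (le_add_of_nonneg_right (Finset.sum_nonneg fun i _ => abs_nonneg _))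
    · rcases (ht i).eq_or_lt with hi | hi
      · rw [← hi, mul_zero]
        exact hray i hi.symm
      · rw [← div_le_iff₀ hi]
        refine (le_abs_self _).trans (le_trans (Finset.single_le_sum
          (f := fun i => |linFormQ c h (g i) / t i|) (fun i _ => abs_nonneg _)
          (Finset.mem_univ i)) (le_add_of_nonneg_left (abs_nonneg γ)))
  -- The slack of `u` serves as normalisation: it is positive on the polyhedron and vanishes only at
  -- the generators in `Z`, the rays of constant objective.
  set u : RatIneq p q := ((c, h), g₀ + 1) with hu
  set Z : I → Prop := fun i => t i = 0 ∧ linFormQ c h (g i) = 0 with hZ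
  have hw0 : ∀ i, 0 ≤ slackQ (g i) (t i) u := fun i => by
    rw [slackQ_apply]
    change 0 ≤ (g₀ + 1) * t i - linFormQ c h (g i)
    linarith [hg₀ i, ht i]
  have hwZ : ∀ i, slackQ (g i) (t i) u = 0 ↔ Z i := fun i => by
    rw [slackQ_apply]
    change (g₀ + 1) * t i - linFormQ c h (g i) = 0 ↔ _
    constructor
    · intro h0
      have : t i = 0 := le_antisymm (by linarith [hg₀ i]) (ht i)
      refine ⟨this, ?_⟩
      rw [this] at h0
      linarith
    · rintro ⟨h1, h2⟩
      rw [h1, h2]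
      ring
  -- Only inequalities blind to the rays in `Z` are evaluated. Weights on these rays can therefore
  -- be dropped, which makes the set of normalised evaluations compact.
  set E : Submodule ℚ (RatIneq p q) := ⨅ i : {i // Z i}, LinearMap.ker (slackQ (g i) (t i)) with hE
  have hmemE : ∀ e, e ∈ E ↔ ∀ i, Z i → slackQ (g i) (t i) e = 0 := fun e => by
    simp [hE, Submodule.mem_iInf]
  obtain ⟨s, a, ha⟩ := Module.Finite.exists_fin (R := ℚ) (M := E)
  have hspan : ∀ e ∈ E, ∃ v : Fin s → ℚ, ∑ j, v j • (a j : RatIneq p q) = e := by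
    intro e he
    have : (⟨e, he⟩ : E) ∈ Submodule.span ℚ (Set.range a) := ha ▸ Submodule.mem_top
    obtain ⟨v, hv⟩ := (Submodule.mem_span_range_iff_exists_fun ℚ).1 this
    refine ⟨v, ?_⟩
    have := congrArg Subtype.val hv
    simpa using this
  have haZ : ∀ j i, Z i → slackQ (g i) (t i) (a j : RatIneq p q) = 0 := fun j =>
    (hmemE _).1 (a j).2
  set w : I → ℝ := fun i => (slackQ (g i) (t i) u : ℝ) with hw
  have hwR0 : ∀ i, 0 ≤ w i := fun i => by simp only [hw]; exact_mod_cast hw0 i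
  have hwRZ : ∀ i, w i = 0 ↔ Z i := fun i => by
    rw [← hwZ i]; simp only [hw]; norm_cast
  -- evaluation of inequalities at a combination of generators
  let ev : (I → ℝ) → RatIneq p q →ₗ[ℚ] ℝ := fun l =>
    { toFun := fun e => ∑ i, l i * (slackQ (g i) (t i) e : ℝ)
      map_add' := fun e e' => by
        simp only [map_add, Rat.cast_add, mul_add, Finset.sum_add_distrib]
      map_smul' := fun r e => by
        simp only [map_smul, smul_eq_mul, Rat.cast_mul, RingHom.id_apply, Rat.smul_def,
          Finset.mul_sum]
        exact Finset.sum_congr rfl fun i _ => by ring }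
  have hev : ∀ l e, ev l e = ∑ i, l i * (slackQ (g i) (t i) e : ℝ) := fun _ _ => rfl
  let ψ : (I → ℝ) →ₗ[ℝ] (Fin s → ℝ) :=
    { toFun := fun l j => ev l (a j)
      map_add' := fun l l' => by
        funext j
        simp only [hev, Pi.add_apply, add_mul, Finset.sum_add_distrib]
      map_smul' := fun r l => by
        funext j
        simp only [hev, Pi.smul_apply, smul_eq_mul, mul_assoc, Finset.mul_sum, RingHom.id_apply] }
  have hψ : ∀ l (v : Fin s → ℚ), ratPair v (ψ l) = ev l (∑ j, v j • (a j : RatIneq p q)) :=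
    fun l v => ratPair_linearMap (ev l) (fun j => (a j : RatIneq p q)) v
  let φ : MixedSpace p q → Fin s → ℝ := fun z j => slack z (a j)
  have hφ : ∀ z (v : Fin s → ℚ), ratPair v (φ z) = slack z (∑ j, v j • (a j : RatIneq p q)) :=
    fun z v => ratPair_linearMap (slack z) (fun j => (a j : RatIneq p q)) v
  have huE : u ∈ E := (hmemE u).2 fun i hi => (hwZ i).2 hi
  have hv₀E : (((c, h), γ) : RatIneq p q) ∈ E := (hmemE _).2 fun i hi => by
    rw [slackQ_apply]
    change γ * t i - linFormQ c h (g i) = 0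
    rw [hi.1, hi.2]; ring
  obtain ⟨vu, hvu⟩ := hspan u huE
  obtain ⟨v₀, hv₀⟩ := hspan _ hv₀E
  have hpos : ∀ z ∈ genSet g t, 0 < slack z u := fun z hz => by
    have := linForm_le_of_genSet hg₀ hz
    rw [slack_apply]
    change 0 < ((g₀ + 1 : ℚ) : ℝ) - linForm c h z
    push_cast
    linarith
  set R : Set ((Fin s → ℚ) × (Fin s → ℚ)) := {v | ∃ (d : Fin p → ℤ) (δ : ℤ),
    ∑ j, v.1 j • (a j : RatIneq p q) = intIneq q d δ ∧
    ∑ j, v.2 j • (a j : RatIneq p q) = intIneq q (-d) (-(δ + 1))} with hR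
  obtain ⟨_, ⟨l, ⟨hl0, hlZ, hl1⟩, rfl⟩, hωv, hωR⟩ := exists_evaluation_of_not_derivable
    (iteratedClosure_antitone k (genSet g t)) φ
    ((isCompact_weightedSimplex w hwR0).image (LinearMap.continuous_of_finiteDimensional ψ))
    ((convex_weightedSimplex w).linear_image ψ) vu
    (by
      rintro _ ⟨l, ⟨-, -, hl⟩, rfl⟩
      rw [hψ, hvu]
      exact hl)
    (fun z hz => by rw [hφ, hvu]; exact hpos z hz)
    (by
      intro z hz
      rw [hφ, hvu]
      have hWpos := hpos z hz
      obtain ⟨l, hl0, hl1, rfl⟩ := hz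
      set W := slack (∑ i, l i • castPt (g i)) u with hW
      refine ⟨fun i => if Z i then 0 else W⁻¹ * l i, ⟨fun i => ?_, fun i hi => ?_, ?_⟩, ?_⟩
      · dsimp only
        split_ifs
        · exact le_rfl
        · exact mul_nonneg (inv_nonneg.2 hWpos.le) (hl0 i)
      · simp [(hwRZ i).1 hi]
      · have hWs : W = ∑ i, l i * w i := slack_sum g t l hl1 u
        rw [← inv_mul_cancel₀ hWpos.ne']
        refine Eq.trans ?_ (congrArg (W⁻¹ * ·) hWs).symm
        dsimp only
        rw [Finset.mul_sum]
        refine Finset.sum_congr rfl fun i _ => ?_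
        split_ifs with hi
        · rw [(hwRZ i).2 hi]; simp
        · rw [mul_assoc]
      · funext j
        change ∑ i, _ * _ = W⁻¹ * slack _ _
        rw [slack_sum g t l hl1, Finset.mul_sum]
        refine Finset.sum_congr rfl fun i _ => ?_
        split_ifs with hi
        · rw [haZ j i hi]; simp
        · rw [mul_assoc])
    R
    (by
      rintro v ⟨d, δ, h1, h2⟩ v' ⟨n, hn⟩
      set e := ∑ j, v' j • (a j : RatIneq p q) with he
      simp only [hφ, h1, h2, ← he] at hn
      have hn' : ∀ z ∈ iteratedClosure k (genSet g t) n,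
          (∑ j, (d j : ℝ) * z.1 j ≤ δ ∨ (δ + 1 : ℝ) ≤ ∑ j, (d j : ℝ) * z.1 j) →
            linForm e.1.1 e.1.2 z ≤ e.2 := by
        intro z hz hor
        have := hn z hz (hor.imp (fun h => by rw [slack_intIneq]; linarith) fun h => by
          rw [slack_intIneq]
          simp only [Pi.neg_apply, Int.cast_neg, neg_mul, Finset.sum_neg_distrib, Int.cast_add,
            Int.cast_one]
          linarith)
        rw [slack_apply] at this
        linarith
      obtain ⟨n', hn''⟩ : Derivable k (genSet g t) e.1.1 e.1.2 e.2 :=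
        derivable_of_split hk (fun z hz hzi =>
          hn' z (mem_iteratedClosure k hz hzi n) (split_of_integer d δ hzi)) n d δ
          fun z hz hlt => by
            by_contra hcon
            refine not_lt.2 (hn' z hz ?_) hlt
            rwa [not_and_or, not_lt, not_lt] at hcon
      refine ⟨n', fun z hz => ?_⟩
      rw [hφ, ← he, slack_apply]
      linarith [hn'' z hz])
    v₀
    (by
      intro n
      by_contra hcon
      push Not at hcon
      refine hnd ⟨n, fun z hz => ?_⟩
      have := hcon z hz
      rw [hφ, hv₀, slack_apply] at this
      linarith)
  -- the real point of the polyhedron with the given evaluation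
  rw [hψ, hv₀] at hωv
  set τ : ℝ := ∑ i, l i * (t i : ℝ) with hτ
  have hevdiff : ev l u - ev l ((c, h), γ) = ((g₀ : ℝ) + 1 - γ) * τ := by
    rw [hev, hev, ← Finset.sum_sub_distrib, hτ, Finset.mul_sum]
    refine Finset.sum_congr rfl fun i _ => ?_
    rw [slackQ_apply, slackQ_apply]
    simp only [hu]
    push_cast
    ring
  have hevu : ev l u = 1 := hl1
  have hgγ : (γ : ℝ) ≤ g₀ := by exact_mod_cast hg₀γ
  -- The evaluation does not escape to infinity: `u` evaluates to `1` and the target to at most `0`,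
  -- and their difference is `(g₀ + 1 - γ) * τ`.
  have hτ0 : 0 < τ := by
    by_contra hneg
    have := mul_nonpos_of_nonneg_of_nonpos (show 0 ≤ (g₀ : ℝ) + 1 - γ by linarith) (not_lt.1 hneg)
    linarith
  have hlτ : ∑ i, l i / τ * (t i : ℝ) = 1 := by
    simp_rw [div_mul_eq_mul_div]
    rw [← Finset.sum_div, ← hτ, div_self hτ0.ne']
  set z₀ : MixedSpace p q := ∑ i, (l i / τ) • castPt (g i) with hz₀
  have hslack : ∀ e, slack z₀ e = ev l e / τ := fun e => by
    rw [hz₀, slack_sum g t _ hlτ, hev, Finset.sum_div]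
    exact Finset.sum_congr rfl fun i _ => by ring
  have hz₀γ : (γ : ℝ) ≤ linForm c h z₀ := by
    have h1 := hslack ((c, h), γ)
    rw [slack_apply] at h1
    have h2 : ev l ((c, h), γ) / τ ≤ 0 := div_nonpos_of_nonpos_of_nonneg hωv hτ0.le
    change (γ : ℝ) - linForm c h z₀ = _ at h1
    linarith
  choose r hr using hint
  obtain ⟨μ, hμ⟩ := exists_integer_translate (fun i => if Z i then r i else 0) z₀.1 (by
    intro d hd
    -- The split with this floor is among the rules since `d` is orthogonal to the rays in `Z`; `d x
    -- ≥ δ + 1` is impossible, so `d x = δ`.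
    set δ : ℤ := ⌊∑ j, (d j : ℝ) * z₀.1 j⌋ with hδ
    have hdE : ∀ (d' : Fin p → ℤ) (δ' : ℤ), (∀ i, Z i → ∑ j, d' j * r i j = 0) →
        intIneq q d' δ' ∈ E := fun d' δ' h' => (hmemE _).2 fun i hi => by
      rw [slackQ_apply]
      simp only [intIneq, linFormQ, hi.1, hr, Pi.zero_apply, zero_mul, Finset.sum_const_zero]
      have : ((∑ j, d' j * r i j : ℤ) : ℚ) = 0 := by rw [h' i hi]; rfl
      push_cast at this
      rw [this]; ring
    have hdZ : ∀ i, Z i → ∑ j, d j * r i j = 0 := fun i hi => by simpa [hi] using hd i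
    obtain ⟨v₁, hv₁⟩ := hspan _ (hdE d δ hdZ)
    obtain ⟨v₂, hv₂⟩ := hspan _ (hdE (-d) (-(δ + 1)) fun i hi => by
      simp [hdZ i hi])
    have hdisj := hωR (v₁, v₂) ⟨d, δ, hv₁, hv₂⟩
    simp only [hψ, hv₁, hv₂] at hdisj
    refine ⟨δ, le_antisymm ?_ (Int.floor_le _)⟩
    rcases hdisj with h1 | h1
    · have h2 := hslack (intIneq q d δ)
      rw [slack_intIneq] at h2
      have := div_nonneg h1 hτ0.le
      linarith
    · have h2 := hslack (intIneq q (-d) (-(δ + 1)))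
      rw [slack_intIneq] at h2
      simp only [Pi.neg_apply, Int.cast_neg, neg_mul, Finset.sum_neg_distrib, Int.cast_add,
        Int.cast_one] at h2
      have := div_nonneg h1 hτ0.le
      have := Int.lt_floor_add_one (∑ j, (d j : ℝ) * z₀.1 j)
      linarith)
  -- Adding `⌈|μ i|⌉₊` makes the multipliers nonnegative, so the point stays in the polyhedron, and
  -- changes the `x`-part only by an integer vector.
  set m : I → ℝ := fun i => if Z i then μ i + (⌈|μ i|⌉₊ : ℝ) else 0 with hm
  have hm0 : ∀ i, 0 ≤ m i := fun i => by
    simp only [hm]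
    split_ifs
    · linarith [Nat.le_ceil |μ i|, neg_abs_le (μ i)]
    · exact le_rfl
  have hmt : ∀ i, m i * (t i : ℝ) = 0 := fun i => by
    simp only [hm]
    split_ifs with hi
    · rw [hi.1]; simp
    · simp
  have hmc : ∀ i, m i * (linFormQ c h (g i) : ℝ) = 0 := fun i => by
    simp only [hm]
    split_ifs with hi
    · rw [hi.2]; simp
    · simp
  set z₁ : MixedSpace p q := z₀ + ∑ i, m i • castPt (g i) with hz₁
  refine not_lt.2 hz₀γ ?_
  have hceq : linForm c h z₁ = linForm c h z₀ := by
    have : linForm c h (∑ i, m i • castPt (g i)) = 0 := by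
      rw [← linFormₗ_apply, map_sum]
      refine Finset.sum_eq_zero fun i _ => ?_
      rw [map_smul, smul_eq_mul, linFormₗ_apply, linForm_castPt, hmc]
    rw [hz₁, linForm_add, this, add_zero]
  rw [← hceq]
  refine hno z₁ ⟨fun i => l i / τ + m i, fun i => add_nonneg (div_nonneg (hl0 i) hτ0.le) (hm0 i),
    ?_, ?_⟩ ?_
  · simp only [add_mul, hlτ, hmt, add_zero]
  · simp only [add_smul, Finset.sum_add_distrib, hz₁, hz₀]
  · have hx : z₁.1 = (fun j => z₀.1 j + ∑ i, μ i * (((if Z i then r i else 0) j : ℤ) : ℝ))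
        + ∑ i, (((if Z i then (⌈|μ i|⌉₊ : ℤ) else 0) : ℤ) : ℝ) • (castPt (g i)).1 := by
      funext j
      simp only [hz₁, Prod.fst_add, Prod.fst_sum, Prod.smul_fst, Pi.add_apply, Finset.sum_apply,
        Pi.smul_apply, smul_eq_mul, add_assoc, ← Finset.sum_add_distrib]
      congr 1
      refine Finset.sum_congr rfl fun i _ => ?_
      by_cases hi : Z i
      · simp [hm, hi, castPt, hr]; ring
      · simp [hm, hi]
    rw [hx]
    exact add_mem_integerPoints hμ (sum_mem_integerPoints _ fun i _ =>
      int_smul_mem_integerPoints (castPt_mem_integerPoints fun j => ⟨r i j, hr i j⟩) _)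

/-! ### Relative interiors of convex sets. -/

section RelativeInterior

variable {V : Type*} [NormedAddCommGroup V] [NormedSpace ℝ V] {S : Set V}

theorem mem_intrinsicInterior_iff_dist {x : V} :
    x ∈ intrinsicInterior ℝ S ↔ x ∈ affineSpan ℝ S ∧
      ∃ ε > 0, ∀ w ∈ affineSpan ℝ S, dist w x < ε → w ∈ S := by
  rw [mem_intrinsicInterior]
  constructor
  · rintro ⟨y, hy, rfl⟩
    obtain ⟨ε, hε, h⟩ := Metric.mem_nhds_iff.1 (mem_interior_iff_mem_nhds.1 hy)
    exact ⟨y.2, ε, hε, fun w hw hd => @h ⟨w, hw⟩ hd⟩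
  · rintro ⟨hx, ε, hε, h⟩
    exact ⟨⟨x, hx⟩, mem_interior_iff_mem_nhds.2 (Metric.mem_nhds_iff.2
      ⟨ε, hε, fun w hw => h w w.2 hw⟩), rfl⟩

theorem exists_prolongation_of_mem_intrinsicInterior {x y : V} (hx : x ∈ intrinsicInterior ℝ S)
    (hy : y ∈ S) : ∃ ε : ℝ, 0 < ε ∧ x + ε • (x - y) ∈ S := by
  obtain ⟨hxS, ε, hε, h⟩ := mem_intrinsicInterior_iff_dist.1 hx
  refine ⟨ε / (2 * (‖x - y‖ + 1)), by positivity, h _ ?_ ?_⟩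
  · have := (affineSpan ℝ S).smul_vsub_vadd_mem (ε / (2 * (‖x - y‖ + 1))) hxS
      (subset_affineSpan ℝ S hy) hxS
    rw [vsub_eq_sub, vadd_eq_add, add_comm] at this
    exact this
  · rw [dist_self_add_left, norm_smul, Real.norm_of_nonneg (by positivity), div_mul_eq_mul_div,
      div_lt_iff₀ (by positivity)]
    nlinarith [norm_nonneg (x - y), mul_nonneg hε.le (norm_nonneg (x - y))]

/-- The homothety with centre `y` and ratio `θ` carries a relative ball around `x` to one around the
new point. -/
theorem segment_mem_intrinsicInterior (hS : Convex ℝ S) {x y : V}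
    (hx : x ∈ intrinsicInterior ℝ S) (hy : y ∈ S) {θ : ℝ} (hθ : 0 < θ) (hθ1 : θ ≤ 1) :
    y + θ • (x - y) ∈ intrinsicInterior ℝ S := by
  obtain ⟨hxS, ε, hε, h⟩ := mem_intrinsicInterior_iff_dist.1 hx
  have hyS := subset_affineSpan ℝ S hy
  refine mem_intrinsicInterior_iff_dist.2 ⟨?_, θ * ε, mul_pos hθ hε, fun w hw hd => ?_⟩
  · have := (affineSpan ℝ S).smul_vsub_vadd_mem θ hxS hyS hyS
    rw [vsub_eq_sub, vadd_eq_add, add_comm] at this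
    exact this
  · have hmem : y + θ⁻¹ • (w - y) ∈ S := by
      refine h _ ?_ ?_
      · have := (affineSpan ℝ S).smul_vsub_vadd_mem θ⁻¹ hw hyS hyS
        rw [vsub_eq_sub, vadd_eq_add, add_comm] at this
        exact this
      · have e : y + θ⁻¹ • (w - y) - x = θ⁻¹ • (w - (y + θ • (x - y))) := by
          rw [← sub_sub w y, smul_sub θ⁻¹ (w - y), inv_smul_smul₀ hθ.ne']
          abel
        rw [dist_eq_norm, e, norm_smul, norm_inv, Real.norm_of_nonneg hθ.le, ← dist_eq_norm,
          inv_mul_lt_iff₀ hθ]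
        exact hd
    have := hS hy hmem (sub_nonneg.2 hθ1) hθ.le (sub_add_cancel 1 θ)
    rw [smul_add, smul_inv_smul₀ hθ.ne', ← add_assoc, ← add_smul, sub_add_cancel, one_smul,
      add_sub_cancel] at this
    exact this

/-- If `L y < δ`, the segment from `y` to a relative interior point would contain a relative
interior point with `L = δ`. -/
theorem le_of_forall_intrinsicInterior_lt [FiniteDimensional ℝ V] (hS : Convex ℝ S)
    (L : V →ₗ[ℝ] ℝ) {δ : ℝ} (h : ∀ x ∈ intrinsicInterior ℝ S, δ < L x) {y : V} (hy : y ∈ S) :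
    δ ≤ L y := by
  obtain ⟨x, hx⟩ := Set.Nonempty.intrinsicInterior hS ⟨y, hy⟩
  by_contra hlt
  push Not at hlt
  have hxL := h x hx
  have hpos : 0 < L x - L y := by linarith
  have := h _ (segment_mem_intrinsicInterior hS hx hy (θ := (δ - L y) / (L x - L y))
    (div_pos (by linarith) hpos) ((div_le_one hpos).2 (by linarith)))
  rw [map_add, map_smul, map_sub, smul_eq_mul, div_mul_cancel₀ _ hpos.ne'] at this
  linarith

end RelativeInterior

/-! ### Projections and duality over an integer fibre. -/

theorem projX_eq_image {p q : ℕ} (C : Set (MixedSpace p q)) : projX C = Prod.fst '' C := by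
  ext x
  simp [projX]

theorem convex_projX {p q : ℕ} {C : Set (MixedSpace p q)} (hC : Convex ℝ C) :
    Convex ℝ (projX C) := by
  rw [projX_eq_image]
  exact hC.linear_image (LinearMap.fst ℝ _ _)

/-- The integral linear form `d x`. -/
def intForm {p : ℕ} (d : Fin p → ℤ) : (Fin p → ℝ) →ₗ[ℝ] ℝ where
  toFun x := ∑ j, (d j : ℝ) * x j
  map_add' x y := by simp [mul_add, Finset.sum_add_distrib]
  map_smul' r x := by
    simp only [Pi.smul_apply, smul_eq_mul, RingHom.id_apply, Finset.mul_sum]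
    exact Finset.sum_congr rfl fun j _ => by ring

theorem intForm_apply {p : ℕ} (d : Fin p → ℤ) (x : Fin p → ℝ) :
    intForm d x = ∑ j, (d j : ℝ) * x j := rfl

/-- An inequality valid at the mixed integer points is bounded on the polyhedron by a supergradient
at an integer point of its projection. -/
theorem exists_supergradient {m p q : ℕ} (A : Matrix (Fin m) (Fin p) ℚ)
    (G : Matrix (Fin m) (Fin q) ℚ) (b : Fin m → ℚ) {c : Fin p → ℚ} {h : Fin q → ℚ} {γ : ℚ}
    (hval : ∀ z ∈ polyhedron A G b, z.1 ∈ integerPoints p → linForm c h z ≤ γ)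
    {u : Fin p → ℤ} (hu : (fun j => (u j : ℝ)) ∈ projX (polyhedron A G b)) :
    ∃ w : Fin p → ℚ, ∀ z ∈ polyhedron A G b,
      linForm c h z ≤ γ + ∑ j, (w j : ℝ) * (z.1 j - u j) := by
  obtain ⟨I, hI, g, t, ht, -, -, hF, hfarkas⟩ :=
    polyhedron_generators (p := 0) (fun _ => 0) G (fibreRhs A b u)
  obtain ⟨y₀, hy₀⟩ := hu
  have hne : (genSet g t).Nonempty :=
    ⟨(0, y₀), hF ▸ (mem_fibre_iff A G b u y₀ 0).2 hy₀⟩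
  have hle : ∀ i, linFormQ (fun _ => 0) h (g i) ≤ (γ - ∑ j, c j * u j) * t i := by
    intro i
    have := le_of_genSet_le (linFormₗ (fun _ => 0) h) (γ := ((γ - ∑ j, c j * u j : ℚ) : ℝ)) ht hne
      (by
        rintro ⟨x, y⟩ hz
        rw [← hF, mem_fibre_iff] at hz
        have := hval _ hz ⟨u, rfl⟩
        simp only [linForm] at this
        simp only [linFormₗ_apply, linForm, Finset.univ_eq_empty, Finset.sum_empty, zero_add]
        push_cast
        linarith) i
    rw [linFormₗ_apply, linForm_castPt] at this
    exact_mod_cast this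
  obtain ⟨v, hv, -, hvh, hvb⟩ := hfarkas _ h _ hle
  -- Let `v` be Farkas multipliers for the bound over the fibre of `u`. Aggregating the rows of the
  -- polyhedron with `v` eliminates `y`, and the residual coefficients of `x` form `w`.
  refine ⟨fun j => c j - ∑ k, v k * A k j, fun z hz => ?_⟩
  have h1 : ∑ k, (v k : ℝ) * linForm (A k) (G k) z ≤ ∑ k, (v k : ℝ) * b k :=
    Finset.sum_le_sum fun k _ => mul_le_mul_of_nonneg_left (hz k) (by exact_mod_cast hv k)
  have h2 : ∑ k, (v k : ℝ) * b k - ∑ k, (v k : ℝ) * ∑ j, (A k j : ℝ) * u j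
      ≤ γ - ∑ j, (c j : ℝ) * u j := by
    have : ((∑ k, v k * fibreRhs A b u k : ℚ) : ℝ) ≤ ((γ - ∑ j, c j * u j : ℚ) : ℝ) := by
      exact_mod_cast hvb
    simp only [fibreRhs] at this
    push_cast at this
    simpa only [mul_sub, Finset.sum_sub_distrib] using this
  have hswap : ∀ (N : ℕ) (B : Matrix (Fin m) (Fin N) ℚ) (x : Fin N → ℝ),
      ∑ k, (v k : ℝ) * ∑ j, (B k j : ℝ) * x j = ∑ j, (∑ k, (v k : ℝ) * B k j) * x j := by
    intro N B x
    simp_rw [Finset.mul_sum, Finset.sum_mul]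
    rw [Finset.sum_comm]
    exact Finset.sum_congr rfl fun j _ => Finset.sum_congr rfl fun k _ => by ring
  simp only [linForm, mul_add, Finset.sum_add_distrib, hswap] at h1 h2 ⊢
  have h3 : ∀ j, (h j : ℝ) = ∑ k, (v k : ℝ) * G k j := fun j => by
    rw [hvh j]; push_cast; rfl
  simp only [h3]
  push_cast
  simp only [sub_mul, mul_sub, Finset.sum_sub_distrib]
  linarith

/-! ### Tight faces and perturbations of valid inequalities. -/

section Faces

variable {p q : ℕ} {J : Type} [Fintype J] {g : J → (Fin p → ℚ) × (Fin q → ℚ)} {s : J → ℚ}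

theorem slack_add_smul (z r : MixedSpace p q) (ν : ℝ) (e : RatIneq p q) :
    slack (z + ν • r) e = slack z e - ν * linForm e.1.1 e.1.2 r := by
  rw [slack_apply, slack_apply, linForm_add, linForm_smul]
  ring

theorem slack_nonneg_of_genSet {e : RatIneq p q} (he : ∀ j, 0 ≤ slackQ (g j) (s j) e)
    {z : MixedSpace p q} (hz : z ∈ genSet g s) : 0 ≤ slack z e := by
  obtain ⟨l, hl, hl1, rfl⟩ := hz
  rw [slack_sum g s l hl1]
  exact Finset.sum_nonneg fun j _ => mul_nonneg (hl j) (by exact_mod_cast he j)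

/-- The face of the generated set on which an inequality is tight. -/
def tightFace (g : J → (Fin p → ℚ) × (Fin q → ℚ)) (s : J → ℚ) (e : RatIneq p q) :
    Set (MixedSpace p q) :=
  {z | z ∈ genSet g s ∧ slack z e = 0}

theorem convex_tightFace (e : RatIneq p q) : Convex ℝ (tightFace g s e) := by
  rintro x ⟨hx, hx0⟩ y ⟨hy, hy0⟩ a b ha hb hab
  refine ⟨convex_genSet hx hy ha hb hab, ?_⟩
  rw [slack_apply] at hx0 hy0 ⊢
  rw [linForm_add, linForm_smul, linForm_smul, ← one_mul (e.2 : ℝ), ← hab]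
  linear_combination a * hx0 + b * hy0

/-- The slack of `e` is a nonnegative combination of the generator slacks, so a tight point gives
weight only to tight generators. -/
theorem slack_eq_zero_of_tightFace {e f : RatIneq p q} (he : ∀ j, 0 ≤ slackQ (g j) (s j) e)
    (hf : ∀ j, slackQ (g j) (s j) e = 0 → slackQ (g j) (s j) f = 0) {z : MixedSpace p q}
    (hz : z ∈ tightFace g s e) : slack z f = 0 := by
  obtain ⟨⟨l, hl, hl1, rfl⟩, h0⟩ := hz
  rw [slack_sum g s l hl1] at h0 ⊢
  have hall := (Finset.sum_eq_zero_iff_of_nonneg fun j _ =>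
    mul_nonneg (hl j) (by exact_mod_cast he j)).1 h0
  refine Finset.sum_eq_zero fun j hj => ?_
  rcases mul_eq_zero.1 (hall j hj) with h | h
  · rw [h, zero_mul]
  · rw [hf j (by exact_mod_cast h)]
    simp

/-- A tight generator either scales to a point of the face or is a ray along which the face is
invariant. -/
theorem slackQ_nonneg_of_tightFace {e f : RatIneq p q} (hs : ∀ j, 0 ≤ s j)
    (hne : (tightFace g s e).Nonempty) (hf : ∀ z ∈ tightFace g s e, 0 ≤ slack z f) {j : J}
    (hj : slackQ (g j) (s j) e = 0) : 0 ≤ slackQ (g j) (s j) f := by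
  rw [slackQ_apply] at hj ⊢
  rcases (hs j).eq_or_lt with h0 | h0
  · obtain ⟨z, hz, hz0⟩ := hne
    rw [← h0, mul_zero, zero_sub] at hj ⊢
    have := nonpos_of_mul_nat_le (a := -slack z f) (b := linForm f.1.1 f.1.2 (castPt (g j)))
      (c := 0) fun n => by
        have h1 := hf (z + (n : ℝ) • castPt (g j))
          ⟨add_smul_mem_genSet hz h0.symm (Nat.cast_nonneg n), by
            rw [slack_add_smul, hz0, linForm_castPt, neg_eq_zero.1 hj]; simp⟩
        rw [slack_add_smul] at h1
        linarith
    rw [linForm_castPt] at this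
    have h2 : linFormQ f.1.1 f.1.2 (g j) ≤ 0 := by exact_mod_cast this
    linarith
  · have h0' : (0 : ℝ) < s j := by exact_mod_cast h0
    have key : ∀ e : RatIneq p q, slack ((s j : ℝ)⁻¹ • castPt (g j)) e
        = (s j : ℝ)⁻¹ * ((e.2 * s j - linFormQ e.1.1 e.1.2 (g j) : ℚ) : ℝ) := by
      intro e
      rw [slack_apply, linForm_smul, linForm_castPt]
      push_cast
      field_simp
    have h1 := hf _ ⟨inv_smul_mem_genSet h0, by rw [key, hj]; simp⟩
    rw [key] at h1
    exact_mod_cast (mul_nonneg_iff_of_pos_left (inv_pos.2 h0')).1 h1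

/-- An inequality `e` valid for the generators can be perturbed by a small multiple of an
inequality valid on its tight face. -/
theorem exists_perturbation {e f : RatIneq p q} (he : ∀ j, 0 ≤ slackQ (g j) (s j) e)
    (hf : ∀ j, slackQ (g j) (s j) e = 0 → 0 ≤ slackQ (g j) (s j) f) :
    ∃ r : ℚ, 0 < r ∧ ∀ j, 0 ≤ slackQ (g j) (s j) (e + r • f) ∧
      (slackQ (g j) (s j) (e + r • f) = 0 →
        slackQ (g j) (s j) e = 0 ∧ slackQ (g j) (s j) f = 0) := by
  have hall : ∀ j, ∃ ε : ℚ, 0 < ε ∧ ∀ r : ℚ, 0 < r → r < ε →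
      0 ≤ slackQ (g j) (s j) (e + r • f) ∧ (slackQ (g j) (s j) (e + r • f) = 0 →
        slackQ (g j) (s j) e = 0 ∧ slackQ (g j) (s j) f = 0) := by
    intro j
    simp only [map_add, map_smul, smul_eq_mul]
    set x := slackQ (g j) (s j) e
    set y := slackQ (g j) (s j) f
    rcases (he j).eq_or_lt with h0 | h0
    · refine ⟨1, one_pos, fun r hr _ => ?_⟩
      change 0 = x at h0
      rw [← h0, zero_add]
      exact ⟨mul_nonneg hr.le (hf j h0.symm), fun h => ⟨rfl, by simpa [hr.ne'] using h⟩⟩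
    · refine ⟨x / (|y| + 1), div_pos h0 (by positivity), fun r hr hlt => ?_⟩
      rw [lt_div_iff₀ (by positivity)] at hlt
      have : 0 < x + r * y := by nlinarith [mul_le_mul_of_nonneg_left (neg_abs_le y) hr.le]
      exact ⟨this.le, fun h => absurd h this.ne'⟩
  choose ε hε h using hall
  by_cases hJ : (Finset.univ : Finset J).Nonempty
  · set η := Finset.univ.inf' hJ ε with hη
    have hη0 : 0 < η := (Finset.lt_inf'_iff _).2 fun j _ => hε j
    refine ⟨η / 2, half_pos hη0, fun j => h j _ (half_pos hη0) ?_⟩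
    have : η ≤ ε j := Finset.inf'_le _ (Finset.mem_univ j)
    linarith
  · exact ⟨1, one_pos, fun j => absurd ⟨j, Finset.mem_univ j⟩ hJ⟩

/-- This makes the hypothesis on the faces of `M` applicable: a tight face inside `M`, if nonempty,
is where the form of `e` is maximal on `M`. -/
theorem isExposed_tightFace {e : RatIneq p q} (he : ∀ j, 0 ≤ slackQ (g j) (s j) e)
    {M : Set (MixedSpace p q)} (hM : M ⊆ genSet g s) (heM : tightFace g s e ⊆ M) :
    IsExposed ℝ M (tightFace g s e) := by
  rintro ⟨z₁, hz₁⟩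
  refine ⟨LinearMap.toContinuousLinearMap (linFormₗ e.1.1 e.1.2), ?_⟩
  ext z
  simp only [LinearMap.coe_toContinuousLinearMap', linFormₗ_apply, Set.mem_ofPred_eq]
  constructor
  · intro hz
    refine ⟨heM hz, fun y hy => ?_⟩
    have h1 := slack_nonneg_of_genSet he (hM hy)
    have h2 := hz.2
    rw [slack_apply] at h1 h2
    linarith
  · rintro ⟨hz, hmax⟩
    refine ⟨hM hz, ?_⟩
    have h1 := slack_nonneg_of_genSet he (hM hz)
    have h2 := hz₁.2
    have h3 := hmax z₁ (heM hz₁)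
    rw [slack_apply] at h1 h2 ⊢
    linarith

end Faces

/-! ### Derivation of the objective bound. -/

section Main

variable {m p q k : ℕ} {A : Matrix (Fin m) (Fin p) ℚ} {G : Matrix (Fin m) (Fin q) ℚ}
  {b : Fin m → ℚ} {J : Type} [Fintype J] {g : J → (Fin p → ℚ) × (Fin q → ℚ)} {s : J → ℚ}

/-- Each integral ray of the polyhedron is a recession direction of the hull, so validity of `e`
there supplies the required bound on the recession cone. -/
theorem derivable_of_valid_of_forall_integer_lt (hk : 2 ≤ k)
    (hhull : mixedIntegerHull (polyhedron A G b) = genSet g s) (hne : (genSet g s).Nonempty)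
    {e : RatIneq p q} (he : ∀ j, 0 ≤ slackQ (g j) (s j) e) {γ : ℚ}
    (hlt : ∀ z ∈ polyhedron A G b, z.1 ∈ integerPoints p → linForm e.1.1 e.1.2 z < γ) :
    Derivable k (polyhedron A G b) e.1.1 e.1.2 γ := by
  obtain ⟨I, _, g', t, ht, hint, -, hP, -⟩ := polyhedron_generators A G b
  rw [← hhull, mixedIntegerHull, convexHull_nonempty_iff] at hne
  obtain ⟨z₀, hz₀, hz₀i⟩ := hne
  rw [hP] at hlt hz₀ ⊢
  refine derivable_of_forall_integer_lt hk ht hint (fun i hi => ?_) hlt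
  have := nonpos_of_mul_nat_le (a := linForm e.1.1 e.1.2 z₀)
    (b := linForm e.1.1 e.1.2 (castPt (g' i))) (c := e.2) fun n => by
      have hmem : z₀ + (n : ℝ) • castPt (g' i) ∈ mixedIntegerHull (polyhedron A G b) :=
        subset_convexHull ℝ _ ⟨hP ▸ add_smul_mem_genSet hz₀ hi (Nat.cast_nonneg n),
          add_mem_integerPoints hz₀i (by
            exact_mod_cast int_smul_mem_integerPoints (castPt_mem_integerPoints (hint i)) n)⟩
      have h1 := slack_nonneg_of_genSet he (hhull ▸ hmem)
      rw [slack_add_smul, slack_apply] at h1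
      linarith
  rw [linForm_castPt] at this
  exact_mod_cast this

theorem linForm_le_of_integer (hhull : mixedIntegerHull (polyhedron A G b) = genSet g s)
    {e : RatIneq p q} (he : ∀ j, 0 ≤ slackQ (g j) (s j) e) {z : MixedSpace p q}
    (hz : z ∈ polyhedron A G b) (hzi : z.1 ∈ integerPoints p) : linForm e.1.1 e.1.2 z ≤ e.2 := by
  have := slack_nonneg_of_genSet he (hhull ▸ subset_convexHull ℝ _ ⟨hz, hzi⟩ : z ∈ genSet g s)
  rw [slack_apply] at this
  linarith

/-- If the relative interior of the projection of the tight face contains an integer point, then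
the inequality is derivable with split cuts. -/
theorem derivable_of_integer_mem_intrinsicInterior (hk : 2 ≤ k) (hs : ∀ j, 0 ≤ s j)
    (hhull : mixedIntegerHull (polyhedron A G b) = genSet g s)
    {e : RatIneq p q} (he : ∀ j, 0 ≤ slackQ (g j) (s j) e) (hne : (tightFace g s e).Nonempty)
    {u : Fin p → ℤ}
    (hu : (fun j => (u j : ℝ)) ∈ intrinsicInterior ℝ (projX (tightFace g s e))) :
    Derivable k (polyhedron A G b) e.1.1 e.1.2 e.2 := by
  have hsub : tightFace g s e ⊆ polyhedron A G b := fun z hz =>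
    iteratedClosure_subset k _ 0 (mixedIntegerHull_subset_iteratedClosure k
      (convex_polyhedron A G b) 0 (hhull ▸ hz.1))
  obtain ⟨y₀, hy₀⟩ := intrinsicInterior_subset hu
  obtain ⟨w, hw⟩ := exists_supergradient A G b (γ := e.2)
    (fun z hz hzi => linForm_le_of_integer hhull he hz hzi) ⟨y₀, hsub hy₀⟩
  obtain ⟨N, hN0, hN⟩ := exists_nat_mul_eq_int w
  choose d hd using hN
  set δ : ℤ := ∑ j, d j * u j with hδ
  have hNR : (0 : ℝ) < N := by exact_mod_cast hN0
  have hdw : ∀ x : Fin p → ℝ, intForm d x - δ = N * ∑ j, (w j : ℝ) * (x j - u j) := by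
    intro x
    have h1 : ∀ j, (d j : ℝ) = N * w j := fun j => by exact_mod_cast (hd j).symm
    rw [hδ, intForm_apply]
    push_cast
    rw [← Finset.sum_sub_distrib, Finset.mul_sum]
    exact Finset.sum_congr rfl fun j _ => by rw [h1]; ring
  have hwd : ∀ z ∈ polyhedron A G b, N * (linForm e.1.1 e.1.2 z - e.2) ≤ intForm d z.1 - δ := by
    intro z hz
    rw [hdw]
    exact mul_le_mul_of_nonneg_left (by linarith [hw z hz]) hNR.le
  have hface : ∀ z ∈ tightFace g s e, 0 ≤ intForm d z.1 - δ := fun z hz => by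
    have h1 := hwd z (hsub hz)
    have h2 := hz.2
    rw [slack_apply] at h2
    rwa [show linForm e.1.1 e.1.2 z - e.2 = 0 by linarith, mul_zero] at h1
  have hudδ : intForm d (fun j => (u j : ℝ)) = δ := by
    rw [intForm_apply, hδ]; push_cast; rfl
  -- On the face `d x ≥ δ`, with equality at the relative interior point `u`. Prolonging past `u`,
  -- away from `z`, forces `d x ≤ δ` too.
  have hface' : ∀ z ∈ tightFace g s e, 0 ≤ slack z (intIneq q d δ) := fun z hz => by
    obtain ⟨ε, hε, y, hy⟩ := exists_prolongation_of_mem_intrinsicInterior hu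
      (show z.1 ∈ projX (tightFace g s e) from ⟨z.2, hz⟩)
    have h1 := hface _ hy
    change 0 ≤ intForm d (_ + ε • (_ - z.1)) - δ at h1
    rw [map_add, map_smul, map_sub, hudδ, smul_eq_mul] at h1
    rw [slack_intIneq, ← intForm_apply]
    refine (mul_nonneg_iff_of_pos_left hε).1 ?_
    linarith
  obtain ⟨r, hr, hpert⟩ := exists_perturbation he fun j hj =>
    slackQ_nonneg_of_tightFace hs hne hface' hj
  set e' := e + r • intIneq q d δ with he'
  have hrR : (0 : ℝ) < r := by exact_mod_cast hr
  -- Relaxing the valid inequality `e'` by `r / 2` makes it strict at mixed integer points. Points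
  -- of the resulting closure that violate `e` have `d x < δ + 1 / 2`, while the supergradient gives
  -- `d x > δ`.
  obtain ⟨n, hn⟩ := derivable_of_valid_of_forall_integer_lt hk hhull ⟨_, hy₀.1⟩
    (fun j => (hpert j).1) (γ := e'.2 + r / 2) fun z hz hzi => by
      have := linForm_le_of_integer hhull (fun j => (hpert j).1) hz hzi
      push_cast
      linarith
  refine derivable_of_split hk (fun z hz hzi => linForm_le_of_integer hhull he hz hzi) n d δ
    fun z hz hlt => ?_
  rw [← intForm_apply]
  constructor
  · have h1 := hwd z (iteratedClosure_subset k _ n hz)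
    have : 0 < N * (linForm e.1.1 e.1.2 z - e.2) := mul_pos hNR (by linarith)
    linarith
  · have h1 := hn z hz
    have h2 : slack z e' = slack z e + r * slack z (intIneq q d δ) := by
      rw [he', map_add, map_smul, Rat.smul_def]
    rw [slack_intIneq, ← intForm_apply, slack_apply, slack_apply] at h2
    push_cast at h1
    have h3 : 0 < (r : ℝ) * (δ + 1 / 2 - intForm d z.1) := by linarith
    have := (mul_pos_iff_of_pos_left hrR).1 h3
    linarith

/-- An inequality tight on a face of `M` is derivable if all exposed faces of `M` without integer
points in the relative interior of their projection admit `k`-disjunctions avoiding it. -/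
theorem derivable_of_tightFace_subset (hk : 2 ≤ k) (hs : ∀ j, 0 ≤ s j)
    (hhull : mixedIntegerHull (polyhedron A G b) = genSet g s) {M : Set (MixedSpace p q)}
    (hM : M ⊆ genSet g s)
    (hfaces : ∀ f : Set (MixedSpace p q), IsExposed ℝ M f →
      intrinsicInterior ℝ (projX f) ∩ integerPoints p = ∅ →
      ∃ (d : Fin k → Fin p → ℤ) (δ : Fin k → ℤ), IsKDisjunction d δ ∧
        ∀ x ∈ intrinsicInterior ℝ (projX f), x ∉ disjunctionSet d δ)
    {e : RatIneq p q} (he : ∀ j, 0 ≤ slackQ (g j) (s j) e) (hne : (tightFace g s e).Nonempty)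
    (heM : tightFace g s e ⊆ M) : Derivable k (polyhedron A G b) e.1.1 e.1.2 e.2 := by
  induction hcard : (Finset.univ.filter fun j => slackQ (g j) (s j) e = 0).card
    using Nat.strong_induction_on generalizing e with
  | _ N ih =>
    by_cases hint : intrinsicInterior ℝ (projX (tightFace g s e)) ∩ integerPoints p = ∅
    swap
    · obtain ⟨_, hx, u, rfl⟩ := Set.nonempty_iff_ne_empty.2 hint
      exact derivable_of_integer_mem_intrinsicInterior hk hs hhull he hne hx
    obtain ⟨d, δ, hd, hU⟩ := hfaces _ (isExposed_tightFace he hM heM) hint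
    have hconv : Convex ℝ (projX (tightFace g s e)) := convex_projX (convex_tightFace e)
    have hUi : ∀ i, ∀ x ∈ intrinsicInterior ℝ (projX (tightFace g s e)),
        (δ i : ℝ) < intForm (d i) x :=
      fun i x hx => not_le.1 fun hle => hU x hx ⟨i, hle⟩
    have hslack : ∀ i z, slack z (intIneq q (-d i) (-δ i)) = intForm (d i) z.1 - δ i := by
      intro i z
      rw [slack_intIneq, intForm_apply]
      simp only [Pi.neg_apply, Int.cast_neg, neg_mul, Finset.sum_neg_distrib]
      ring
    have hder : ∀ i, ∃ r : ℚ, 0 < r ∧ Derivable k (polyhedron A G b)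
        (e + r • intIneq q (-d i) (-δ i)).1.1 (e + r • intIneq q (-d i) (-δ i)).1.2
        (e + r • intIneq q (-d i) (-δ i)).2 := by
      intro i
      set f := intIneq q (-d i) (-δ i) with hf
      have hfn : ∀ z ∈ tightFace g s e, 0 ≤ slack z f := fun z hz => by
        rw [hslack]
        exact sub_nonneg.2 (le_of_forall_intrinsicInterior_lt hconv (intForm (d i)) (hUi i)
          ⟨z.2, hz⟩)
      obtain ⟨r, hr, hpert⟩ := exists_perturbation he fun j hj =>
        slackQ_nonneg_of_tightFace hs hne hfn hj
      refine ⟨r, hr, ?_⟩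
      -- Either the new tight face is nonempty and has fewer tight generators, or no mixed integer
      -- point is tight and the strict case applies.
      by_cases hne' : (tightFace g s (e + r • f)).Nonempty
      · refine ih _ ?_ (fun j => (hpert j).1) hne' (fun z hz => heM ⟨hz.1,
          slack_eq_zero_of_tightFace (fun j => (hpert j).1) (fun j hj => ((hpert j).2 hj).1) hz⟩) rfl
        rw [← hcard]
        refine Finset.card_lt_card (Finset.ssubset_iff_subset_ne.2 ⟨fun j hj => ?_, fun heq => ?_⟩)
        · simp only [Finset.mem_filter, Finset.mem_univ, true_and] at hj ⊢
          exact ((hpert j).2 hj).1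
        · obtain ⟨z₀, hz₀⟩ := hne
          -- With the same tight generators, `d^i x = δ^i` would hold on the whole face, contrary to
          -- strictness at a relative interior point.
          obtain ⟨x, hx⟩ := Set.Nonempty.intrinsicInterior hconv ⟨z₀.1, z₀.2, hz₀⟩
          obtain ⟨y, hy⟩ := intrinsicInterior_subset hx
          have h1 := slack_eq_zero_of_tightFace (f := f) he (fun j hj => by
            have : j ∈ Finset.univ.filter fun j => slackQ (g j) (s j) (e + r • f) = 0 := by
              rw [heq]; simpa using hj
            exact ((hpert j).2 (by simpa using this)).2) hy
          rw [hslack] at h1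
          have := hUi i x hx
          exact absurd h1 (sub_pos.2 this).ne'
      · refine derivable_of_valid_of_forall_integer_lt hk hhull (hne.mono fun z hz => hz.1)
          (fun j => (hpert j).1) fun z hz hzi => ?_
        refine lt_of_le_of_ne (linForm_le_of_integer hhull (fun j => (hpert j).1) hz hzi)
          fun heq => hne' ⟨z, hhull ▸ subset_convexHull ℝ _ ⟨hz, hzi⟩, ?_⟩
        rw [slack_apply, heq, sub_self]
    choose r hr n hn using hder
    refine derivable_of_disjunction (fun z hz hzi => linForm_le_of_integer hhull he hz hzi)
      -- One closure satisfies all the perturbed inequalities at once; there negative slack of `e`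
      -- forces positive slack of each `-d^i x ≤ -δ^i`.
      (Finset.univ.sup n) hd fun z hz hlt i => ?_
    have h1 := hn i z (iteratedClosure_antitone k _ (Finset.le_sup (Finset.mem_univ i)) hz)
    have h2 : slack z (e + r i • intIneq q (-d i) (-δ i))
        = slack z e + r i * slack z (intIneq q (-d i) (-δ i)) := by
      rw [map_add, map_smul, Rat.smul_def]
    rw [hslack, slack_apply, slack_apply] at h2
    have h3 : 0 < (r i : ℝ) * (intForm (d i) z.1 - δ i) := by linarith
    have := (mul_pos_iff_of_pos_left (by exact_mod_cast hr i)).1 h3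
    rw [← intForm_apply]
    linarith

/-- Complementary slackness: the maximum is attained at a generator with `s j > 0`, hence at a
rational point. Rationality lets the objective bound be stored as a `RatIneq`. -/
theorem exists_rat_eq_of_isGreatest (hs : ∀ j, 0 ≤ s j) {c : Fin p → ℚ} {h : Fin q → ℚ} {γ : ℝ}
    (hγ : IsGreatest (linForm c h '' genSet g s) γ) : ∃ γ' : ℚ, γ = γ' := by
  obtain ⟨⟨z, hz, rfl⟩, hub⟩ := hγ
  have hle : ∀ j, (linFormQ c h (g j) : ℝ) ≤ linForm c h z * s j := fun j => by
    rw [← linForm_castPt]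
    exact le_of_genSet_le (linFormₗ c h) hs ⟨z, hz⟩ (fun w hw => hub ⟨w, hw, rfl⟩) j
  set γ := linForm c h z with hγ
  obtain ⟨l, hl, hl1, hlz⟩ := hz
  have hsum : ∑ j, l j * (γ * s j - linFormQ c h (g j)) = 0 := by
    have h1 : γ = ∑ j, l j * (linFormQ c h (g j) : ℝ) := by
      rw [hγ, ← hlz, ← linFormₗ_apply, map_sum]
      exact Finset.sum_congr rfl fun j _ => by
        rw [map_smul, smul_eq_mul, linFormₗ_apply, linForm_castPt]
    have h2 : ∑ j, l j * (γ * s j) = γ := by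
      calc ∑ j, l j * (γ * s j) = γ * ∑ j, l j * (s j : ℝ) := by
            rw [Finset.mul_sum]
            exact Finset.sum_congr rfl fun j _ => by ring
        _ = γ := by rw [hl1, mul_one]
    simp only [mul_sub, Finset.sum_sub_distrib]
    rw [h2, ← h1, sub_self]
  have hall := (Finset.sum_eq_zero_iff_of_nonneg fun j _ =>
    mul_nonneg (hl j) (sub_nonneg.2 (hle j))).1 hsum
  obtain ⟨j, hj⟩ : ∃ j, l j * (s j : ℝ) ≠ 0 := by
    by_contra hno
    push Not at hno
    rw [Finset.sum_eq_zero fun j _ => hno j] at hl1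
    exact zero_ne_one hl1
  have hj1 := (mul_eq_zero.1 (hall j (Finset.mem_univ j))).resolve_left (left_ne_zero_of_mul hj)
  refine ⟨linFormQ c h (g j) / s j, ?_⟩
  push_cast
  rw [eq_div_iff (right_ne_zero_of_mul hj)]
  linarith

end Main

end KDisjunctive

theorem mainTheorem4 {m p q : ℕ} (A : Matrix (Fin m) (Fin p) ℚ) (G : Matrix (Fin m) (Fin q) ℚ)
    (b : Fin m → ℚ) (c : Fin p → ℚ) (h : Fin q → ℚ) (γ : ℝ) (k : ℕ) (hk : 2 ≤ k)
    (hbdd : BddAbove (KDisjunctive.linForm c h '' KDisjunctive.polyhedron A G b))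
    (hγ : IsGreatest
      (KDisjunctive.linForm c h '' KDisjunctive.mixedIntegerHull (KDisjunctive.polyhedron A G b)) γ)
    (hfaces : ∀ f : Set (KDisjunctive.MixedSpace p q),
      IsExposed ℝ (KDisjunctive.solutionSet (KDisjunctive.polyhedron A G b) c h γ) f →
      intrinsicInterior ℝ (KDisjunctive.projX f) ∩ KDisjunctive.integerPoints p = ∅ →
      ∃ (d : Fin k → Fin p → ℤ) (δ : Fin k → ℤ), KDisjunctive.IsKDisjunction d δ ∧
        ∀ x ∈ intrinsicInterior ℝ (KDisjunctive.projX f), x ∉ KDisjunctive.disjunctionSet d δ) :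
    ∃ n : ℕ, IsGreatest
      (KDisjunctive.linForm c h ''
        KDisjunctive.iteratedClosure k (KDisjunctive.polyhedron A G b) n) γ := by
  open KDisjunctive in
  obtain ⟨J, _, g, s, hs, hhull⟩ := mixedIntegerHull_generators A G b
  obtain ⟨γ', rfl⟩ := exists_rat_eq_of_isGreatest hs (hhull ▸ hγ)
  obtain ⟨⟨z, hz, hzγ⟩, hub⟩ := hγ
  have he : ∀ j, 0 ≤ slackQ (g j) (s j) ((c, h), γ') := fun j => by
    have := le_of_genSet_le (linFormₗ c h) hs ⟨z, hhull ▸ hz⟩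
      (fun w hw => hub ⟨w, hhull ▸ hw, rfl⟩) j
    rw [linFormₗ_apply, linForm_castPt] at this
    rw [slackQ_apply]
    exact sub_nonneg.2 (by exact_mod_cast this)
  -- For the objective inequality itself, the tight face is `M`.
  obtain ⟨n, hn⟩ := derivable_of_tightFace_subset hk hs hhull (e := ((c, h), γ'))
    (M := solutionSet (polyhedron A G b) c h γ') (fun w hw => hhull ▸ hw.1) hfaces he
    ⟨z, hhull ▸ hz, by rw [slack_apply]; exact sub_eq_zero.2 hzγ.symm⟩
    (fun w hw => ⟨hhull ▸ hw.1, (sub_eq_zero.1 ((slack_apply _ _).symm.trans hw.2)).symm⟩)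
  refine ⟨n, ⟨z, mixedIntegerHull_subset_iteratedClosure k (convex_polyhedron A G b) n hz, hzγ⟩, ?_⟩
  rintro _ ⟨w, hw, rfl⟩
  exact hn w hw
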